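/- Let $\theta\in\mathbb R$ and $\lambda=e^{2\pi i\theta}$. Let $\mathcal T$ be the Toeplitz algebra, i.e. the universal unital $C^*$-algebra generated by an isometry $v$. Let $\mathcal T\rtimes_\theta\mathbb Z$ be the crossed product of $\mathcal T$ by the automorphism $v\mapsto\lambda v$, with $u$ the implementing unitary (so $uvu^*=\lambda v$). Let $\mathcal T\otimes_\theta\mathcal T$ be the tensor twist, i.e. the universal unital $C^*$-algebra generated by two isometries $u,v$ with $u^*v=\bar\lambda vu^*$. Let $\mathcal K$ be the $C^*$-algebra of compact operators on $\ell^2(\mathbb N_0)$, and for $i\in\mathbb N_0$ let $x_i\in\mathcal K$ be the rank-one partial isometry that sends $e_0$ to $e_i$ and vanishes on $e_0^\perp$ (so $x_i^*x_j=\delta_{ij}x_0$). Write $\otimes$ for the (maximal) $C^*$-tensor product and $\langle p\rangle$ for the closed two-sided ideal generated by $p$. (a) With $u$ also denoting the canonical generating unitary $z\mapsto z$ of $C(S^1)$, there is a $*$-isomorphism from $C(S^1)\otimes\mathcal K$ onto the ideal $\langle 1-vv^*\rangle$ of $\mathcal T\rtimes_\theta\mathbb Z$ such that $$u\otimes x_i\mapsto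 v^iu(1-vv^*)\qquad(i\in\mathbb N_0).$$ (b) With $v$ also denoting the generating isometry of $\mathcal T$, there is a $*$-isomorphism from $\mathcal T\otimes\mathcal K$ onto the ideal $\langle 1-vv^*\rangle$ of $\mathcal T\otimes_\theta\mathcal T$ such that $$v\otimes x_i\mapsto v^iu(1-vv^*),\qquad 1\otimes x_i\mapsto v^i(1-vv^*)\qquad(i\in\mathbb N_0),$$ and there is a $*$-isomorphism from $\mathcal T\otimes\mathcal K$ onto the ideal $\langle 1-uu^*\rangle$ of $\mathcal T\otimes_\theta\mathcal T$ such that $$v\otimes x_i\mapsto u^iv(1-uu^*),\qquad 1\otimes x_i\mapsto u^i(1-uu^*)\qquad(i\in\mathbb N_0).$$ -/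

import Mathlib

noncomputable section

universe u v

/-! ## The involutive algebra of noncommutative polynomials -/

/-- The involutive algebra of noncommutative complex polynomials in the symbols `g` and `g*`,
where `g` runs through `G`. -/
def FreeStarAlgebra (G : Type u) : Type u := FreeAlgebra ℂ (G ⊕ G)

namespace FreeStarAlgebra

variable {G : Type u}

instance : Ring (FreeStarAlgebra G) := inferInstanceAs (Ring (FreeAlgebra ℂ (G ⊕ G)))

instance : Algebra ℂ (FreeStarAlgebra G) := inferInstanceAs (Algebra ℂ (FreeAlgebra ℂ (G ⊕ G)))

/-- The generator attached to `g`. -/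
def of (g : G) : FreeStarAlgebra G := FreeAlgebra.ι ℂ (Sum.inl g)

/-- The generator which is the adjoint of the one attached to `g`. -/
def ofStar (g : G) : FreeStarAlgebra G := FreeAlgebra.ι ℂ (Sum.inr g)

theorem induction_on {motive : FreeStarAlgebra G → Prop}
    (scalar : ∀ r : ℂ, motive (algebraMap ℂ _ r)) (gen : ∀ g, motive (of g))
    (genStar : ∀ g, motive (ofStar g)) (mul : ∀ a b, motive a → motive b → motive (a * b))
    (add : ∀ a b, motive a → motive b → motive (a + b)) (x : FreeStarAlgebra G) : motive x :=
  FreeAlgebra.induction ℂ (G ⊕ G) (motive := motive) scalar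
    (fun s => by cases s with
      | inl g => exact gen g
      | inr g => exact genStar g) mul add x

/-- The algebra homomorphism determined by the values on the symbols. -/
def liftAlg {B : Type v} [Ring B] [Algebra ℂ B] (f f' : G → B) : FreeStarAlgebra G →ₐ[ℂ] B :=
  FreeAlgebra.lift ℂ (Sum.elim f f')

@[simp] theorem liftAlg_of {B : Type v} [Ring B] [Algebra ℂ B] (f f' : G → B) (g : G) :
    liftAlg f f' (of g) = f g := FreeAlgebra.lift_ι_apply (R := ℂ) (Sum.elim f f') (Sum.inl g)

@[simp] theorem liftAlg_ofStar {B : Type v} [Ring B] [Algebra ℂ B] (f f' : G → B) (g : G) :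
    liftAlg f f' (ofStar g) = f' g := FreeAlgebra.lift_ι_apply (R := ℂ) (Sum.elim f f') (Sum.inr g)

/-- The opposite algebra, on which `ℂ` acts through complex conjugation. -/
def ConjOpposite (G : Type u) : Type u := (FreeStarAlgebra G)ᵐᵒᵖ

instance : Ring (ConjOpposite G) := inferInstanceAs (Ring (FreeStarAlgebra G)ᵐᵒᵖ)

instance : Algebra ℂ (ConjOpposite G) :=
  Algebra.compHom (FreeStarAlgebra G)ᵐᵒᵖ (starRingEnd ℂ)

/-- The identity map from polynomials to the opposite algebra. -/
def toConj (x : FreeStarAlgebra G) : ConjOpposite G := MulOpposite.op x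

/-- The identity map from the opposite algebra to polynomials. -/
def ofConj (x : ConjOpposite G) : FreeStarAlgebra G := MulOpposite.unop x

/-- The conjugate-linear antimultiplicative involution exchanging `g` and `g*`. -/
def conj : FreeStarAlgebra G →ₐ[ℂ] ConjOpposite G :=
  liftAlg (fun g => toConj (ofStar g)) (fun g => toConj (of g))

instance : Star (FreeStarAlgebra G) := ⟨fun x => ofConj (conj x)⟩

theorem star_def (x : FreeStarAlgebra G) : star x = ofConj (conj x) := rfl

@[simp] theorem star_of (g : G) : star (of g) = ofStar g := by
  rw [star_def, conj, liftAlg_of]; rfl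

@[simp] theorem star_ofStar (g : G) : star (ofStar g) = of g := by
  rw [star_def, conj, liftAlg_ofStar]; rfl

@[simp] theorem star_scalar (r : ℂ) :
    star (algebraMap ℂ (FreeStarAlgebra G) r) = algebraMap ℂ _ (star r) := by
  rw [star_def, AlgHom.commutes]; rfl

theorem star_mul' (x y : FreeStarAlgebra G) : star (x * y) = star y * star x := by
  rw [star_def, map_mul]; rfl

theorem star_add' (x y : FreeStarAlgebra G) : star (x + y) = star x + star y := by
  rw [star_def, map_add]; rfl

instance : StarRing (FreeStarAlgebra G) where
  star_involutive x := by
    induction x using induction_on with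
    | scalar r => simp
    | gen g => simp
    | genStar g => simp
    | mul a b ha hb => rw [star_mul', star_mul', ha, hb]
    | add a b ha hb => rw [star_add', star_add', ha, hb]
  star_mul := star_mul'
  star_add := star_add'

instance : StarModule ℂ (FreeStarAlgebra G) where
  star_smul r x := by
    rw [Algebra.smul_def, star_mul, star_scalar, ← Algebra.commutes, ← Algebra.smul_def]

/-- The `*`-homomorphism determined by the values on the generators. -/
def lift {B : Type v} [Ring B] [StarRing B] [Algebra ℂ B] [StarModule ℂ B] (f : G → B) :
    FreeStarAlgebra G →⋆ₐ[ℂ] B :=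
  { liftAlg f (fun g => star (f g)) with
    map_star' := fun x => by
      change liftAlg f (fun g => star (f g)) (star x) = star (liftAlg f (fun g => star (f g)) x)
      induction x using induction_on with
      | scalar r => rw [star_scalar, AlgHom.commutes, AlgHom.commutes, algebraMap_star_comm]
      | gen g => simp
      | genStar g => simp
      | mul a b ha hb => rw [star_mul, map_mul, map_mul, star_mul, ha, hb]
      | add a b ha hb => rw [star_add, map_add, map_add, star_add, ha, hb] }

@[simp] theorem lift_of {B : Type v} [Ring B] [StarRing B] [Algebra ℂ B] [StarModule ℂ B]
    (f : G → B) (g : G) : lift f (of g) = f g := liftAlg_of _ _ g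

end FreeStarAlgebra

/-! ## C*-seminorms and their Hausdorff completions -/

/-- A C*-seminorm on a unital complex `*`-algebra. -/
structure CStarSeminorm (P : Type u) [Ring P] [StarRing P] [Algebra ℂ P] extends
    Seminorm ℂ P where
  mul_le' : ∀ x y, toFun (x * y) ≤ toFun x * toFun y
  star_mul_self' : ∀ x, toFun (star x * x) = toFun x ^ 2

namespace CStarSeminorm

variable {P : Type u} [Ring P] [StarRing P] [Algebra ℂ P]

instance : FunLike (CStarSeminorm P) P ℝ where
  coe p := p.toFun
  coe_injective p q h := by
    obtain ⟨p, _, _⟩ := p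
    obtain ⟨q, _, _⟩ := q
    congr
    exact DFunLike.coe_injective h

instance : SeminormClass (CStarSeminorm P) ℂ P where
  map_zero p := p.map_zero'
  map_add_le_add p := p.add_le'
  map_neg_eq_map p := p.neg'
  map_smul_eq_mul p := p.smul'

theorem mul_le (p : CStarSeminorm P) (x y : P) : p (x * y) ≤ p x * p y := p.mul_le' x y

theorem star_mul_self (p : CStarSeminorm P) (x : P) : p (star x * x) = p x ^ 2 :=
  p.star_mul_self' x

theorem le_star (p : CStarSeminorm P) (x : P) : p x ≤ p (star x) := by
  have h := p.mul_le (star x) x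
  rw [p.star_mul_self] at h
  rcases (apply_nonneg p x).eq_or_lt with h0 | h0
  · rw [← h0]; exact apply_nonneg p _
  · nlinarith

theorem map_star (p : CStarSeminorm P) (x : P) : p (star x) = p x :=
  le_antisymm (by simpa using p.le_star (star x)) (p.le_star x)

/-- The `*`-algebra `P`, equipped with the seminorm `p`. -/
def Pre (_p : CStarSeminorm P) : Type u := P

variable (p : CStarSeminorm P)

instance : Ring p.Pre := inferInstanceAs (Ring P)
instance : StarRing p.Pre := inferInstanceAs (StarRing P)
instance : Algebra ℂ p.Pre := inferInstanceAs (Algebra ℂ P)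
instance [StarModule ℂ P] : StarModule ℂ p.Pre := inferInstanceAs (StarModule ℂ P)

/-- The identity map `P → P` as a `*`-homomorphism to `P` with its seminorm. -/
def toPre : P →⋆ₐ[ℂ] p.Pre := StarAlgHom.id ℂ P

/-- The identity map `P → P` as a `*`-homomorphism from `P` with its seminorm. -/
def ofPre : p.Pre →⋆ₐ[ℂ] P := StarAlgHom.id ℂ P

instance : SeminormedRing p.Pre :=
  { (inferInstance : Ring p.Pre),
    AddGroupSeminorm.toSeminormedAddCommGroup (E := p.Pre) p.toAddGroupSeminorm with
    norm_mul_le := p.mul_le' }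

theorem norm_pre (x : p.Pre) : ‖x‖ = p (p.ofPre x) := rfl

instance : NormedAlgebra ℂ p.Pre where
  norm_smul_le r x := (p.smul' r x).le

instance : NormedStarGroup p.Pre where
  norm_star_le x := (p.map_star x).le

/-- The completion of the quotient of `P` by the null space of `p`. -/
abbrev Complete : Type u := UniformSpace.Completion p.Pre

instance : Star p.Complete := ⟨UniformSpace.Completion.map (star : p.Pre → p.Pre)⟩

theorem coe_star (x : p.Pre) : ((star x : p.Pre) : p.Complete) = star (x : p.Complete) :=
  (UniformSpace.Completion.map_coe star_isometry.uniformContinuous x).symm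

instance : ContinuousStar p.Complete :=
  ⟨UniformSpace.Completion.continuous_map (f := (star : p.Pre → p.Pre))⟩

open UniformSpace.Completion in
instance : StarRing p.Complete where
  star_involutive x := by
    induction x using UniformSpace.Completion.induction_on with
    | hp => exact isClosed_eq (continuous_star.comp continuous_star) continuous_id
    | ih x => rw [← coe_star, ← coe_star, star_star]
  star_mul x y := by
    induction x, y using UniformSpace.Completion.induction_on₂ with
    | hp => exact isClosed_eq (by fun_prop) (by fun_prop)
    | ih x y => rw [← coe_mul, ← coe_star, ← coe_star, ← coe_star, star_mul, coe_mul]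
  star_add x y := by
    induction x, y using UniformSpace.Completion.induction_on₂ with
    | hp => exact isClosed_eq (by fun_prop) (by fun_prop)
    | ih x y => rw [← coe_add, ← coe_star, ← coe_star, ← coe_star, star_add, coe_add]

instance : NormedAlgebra ℂ p.Complete where
  norm_smul_le := norm_smul_le

open UniformSpace.Completion in
instance : CStarRing p.Complete where
  norm_mul_self_le x := by
    induction x using UniformSpace.Completion.induction_on with
    | hp => exact isClosed_le (by fun_prop) (by fun_prop)
    | ih x =>
      rw [← coe_star, ← coe_mul, norm_coe, norm_coe, ← sq]
      exact (p.star_mul_self' x).ge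

open UniformSpace.Completion in
instance [StarModule ℂ P] : StarModule ℂ p.Complete where
  star_smul r x := by
    induction x using UniformSpace.Completion.induction_on with
    | hp =>
      exact isClosed_eq (continuous_star.comp (continuous_id.const_smul r))
        ((continuous_star (R := p.Complete)).const_smul (star r))
    | ih x => rw [← coe_smul, ← coe_star, ← coe_star, ← coe_smul, star_smul]

instance [StarModule ℂ P] : CStarAlgebra p.Complete where

variable [StarModule ℂ P]

/-- The canonical map to the completion as a `*`-homomorphism. -/
def toComplete : P →⋆ₐ[ℂ] p.Complete where
  toFun x := (p.toPre x : p.Complete)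
  map_one' := rfl
  map_mul' x y := UniformSpace.Completion.coe_mul (p.toPre x) (p.toPre y)
  map_zero' := rfl
  map_add' x y := UniformSpace.Completion.coe_add (p.toPre x) (p.toPre y)
  commutes' _ := rfl
  map_star' x := p.coe_star (p.toPre x)

theorem norm_toComplete (x : P) : ‖p.toComplete x‖ = p x :=
  UniformSpace.Completion.norm_coe (p.toPre x)

theorem toComplete_induction {motive : p.Complete → Prop} (hc : IsClosed {x | motive x})
    (h : ∀ x : P, motive (p.toComplete x)) (x : p.Complete) : motive x :=
  UniformSpace.Completion.induction_on x hc h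

section Extend

variable {B : Type v} [CStarAlgebra B] (f : P →⋆ₐ[ℂ] B)

theorem continuous_comp_ofPre (hf : ∀ x, ‖f x‖ ≤ p x) :
    Continuous ((f.comp p.ofPre : p.Pre →⋆ₐ[ℂ] B) : p.Pre →+* B) :=
  AddMonoidHomClass.continuous_of_bound ((f.comp p.ofPre : p.Pre →⋆ₐ[ℂ] B) : p.Pre →+* B) 1
    (fun x => by rw [one_mul]; exact hf (p.ofPre x))

/-- Extension of a bounded `*`-homomorphism to the completion, as a ring homomorphism. -/
def extendRing (hf : ∀ x, ‖f x‖ ≤ p x) : p.Complete →+* B :=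
  UniformSpace.Completion.extensionHom _ (p.continuous_comp_ofPre f hf)

theorem extendRing_toComplete (hf : ∀ x, ‖f x‖ ≤ p x) (x : P) : p.extendRing f hf (p.toComplete x) = f x :=
  UniformSpace.Completion.extensionHom_coe _ (p.continuous_comp_ofPre f hf) (p.toPre x)

theorem continuous_extendRing (hf : ∀ x, ‖f x‖ ≤ p x) : Continuous (p.extendRing f hf) :=
  UniformSpace.Completion.continuous_extension

/-- Extension of a bounded `*`-homomorphism to the completion. -/
def extend (hf : ∀ x, ‖f x‖ ≤ p x) : p.Complete →⋆ₐ[ℂ] B :=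
  { p.extendRing f hf with
    commutes' := fun r => (p.extendRing_toComplete f hf (algebraMap ℂ P r)).trans
      (AlgHomClass.commutes f r)
    map_star' := fun x => by
      change p.extendRing f hf (star x) = star (p.extendRing f hf x)
      have hC := p.continuous_extendRing f hf
      induction x using p.toComplete_induction with
      | hc => exact isClosed_eq (hC.comp continuous_star) (continuous_star.comp hC)
      | h x => rw [← StarHomClass.map_star p.toComplete, extendRing_toComplete,
          extendRing_toComplete, StarHomClass.map_star f] }

theorem extend_toComplete (hf : ∀ x, ‖f x‖ ≤ p x) (x : P) : p.extend f hf (p.toComplete x) = f x :=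
  p.extendRing_toComplete f hf x

end Extend

/-- The zero seminorm. -/
instance : Inhabited (CStarSeminorm P) :=
  ⟨{ (0 : Seminorm ℂ P) with
      mul_le' := fun _ _ => (zero_mul (0 : ℝ)).ge
      star_mul_self' := fun _ => (zero_pow two_ne_zero).symm }⟩

/-- The C*-seminorm `x ↦ ‖f x‖` of a `*`-homomorphism `f` to a C*-algebra. -/
def ofHom {B : Type v} [CStarAlgebra B] (f : P →⋆ₐ[ℂ] B) : CStarSeminorm P where
  toFun x := ‖f x‖
  map_zero' := by simp
  add_le' x y := by rw [map_add]; exact norm_add_le _ _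
  neg' x := by rw [map_neg, norm_neg]
  smul' r x := by rw [map_smul, norm_smul]
  mul_le' x y := by rw [map_mul]; exact norm_mul_le _ _
  star_mul_self' x := by rw [map_mul, StarHomClass.map_star f, CStarRing.norm_star_mul_self, sq]

/-- The supremum of a nonempty pointwise bounded set of C*-seminorms. -/
def sup (S : Set (CStarSeminorm P)) (hne : S.Nonempty)
    (hb : ∀ x : P, BddAbove (Set.range fun p : S => p.1 x)) : CStarSeminorm P :=
  haveI : Nonempty S := hne.to_subtype
  have h0 : ∀ x : P, 0 ≤ ⨆ p : S, p.1 x := fun x => Real.iSup_nonneg fun p => apply_nonneg p.1 x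
  { toFun := fun x => ⨆ p : S, p.1 x
    map_zero' := by simp
    add_le' := fun x y => ciSup_le fun p =>
      (map_add_le_add p.1 x y).trans (add_le_add (le_ciSup (hb x) p) (le_ciSup (hb y) p))
    neg' := fun x => by simp only [map_neg_eq_map]
    smul' := fun r x => by
      simp only [map_smul_eq_mul]
      exact (Real.mul_iSup_of_nonneg (norm_nonneg r) _).symm
    mul_le' := fun x y => ciSup_le fun p => (p.1.mul_le x y).trans
      (mul_le_mul (le_ciSup (hb x) p) (le_ciSup (hb y) p) (apply_nonneg p.1 y) (h0 x))
    star_mul_self' := fun x => by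
      refine le_antisymm (ciSup_le fun p => ?_) ?_
      · rw [p.1.star_mul_self]
        exact pow_le_pow_left₀ (apply_nonneg p.1 x) (le_ciSup (hb x) p) 2
      · have hle : (⨆ p : S, p.1 x) ≤ Real.sqrt (⨆ p : S, p.1 (star x * x)) :=
          ciSup_le fun p => Real.le_sqrt_of_sq_le (by
            rw [← p.1.star_mul_self]; exact le_ciSup (hb (star x * x)) p)
        exact (Real.le_sqrt (h0 x) (h0 _)).1 hle }

theorem le_sup {S : Set (CStarSeminorm P)} (hne : S.Nonempty)
    (hb : ∀ x : P, BddAbove (Set.range fun p : S => p.1 x)) {p : CStarSeminorm P} (hp : p ∈ S)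
    (x : P) : p x ≤ sup S hne hb x :=
  le_ciSup (hb x) ⟨p, hp⟩

end CStarSeminorm

/-! ## Universal C*-algebras -/

/-- Generators and `*`-polynomial relations such that every generator is uniformly bounded in all
C*-seminorms on the `*`-algebra generated by `G` subject to the relations, that is, in all
C*-seminorms on polynomials that vanish on the relations. -/
structure CStarPresentation (G : Type u) where
  rel : Set (FreeStarAlgebra G)
  bounded : ∀ g : G, ∃ C : ℝ, ∀ p : CStarSeminorm (FreeStarAlgebra G),
    (∀ r ∈ rel, p r = 0) → p (FreeStarAlgebra.of g) ≤ C

namespace CStarPresentation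

variable {G : Type u} (R : CStarPresentation G)

/-- The C*-seminorms that vanish on the relations. -/
def seminorms : Set (CStarSeminorm (FreeStarAlgebra G)) := {p | ∀ r ∈ R.rel, p r = 0}

theorem seminorms_nonempty : R.seminorms.Nonempty := ⟨default, fun _ _ => rfl⟩

theorem bddAbove (x : FreeStarAlgebra G) :
    BddAbove (Set.range fun p : R.seminorms => p.1 x) := by
  suffices h : ∃ C : ℝ, ∀ p ∈ R.seminorms, p x ≤ C by
    obtain ⟨C, hC⟩ := h
    exact ⟨C, by rintro _ ⟨p, rfl⟩; exact hC p.1 p.2⟩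
  induction x using FreeStarAlgebra.induction_on with
  | scalar r =>
    refine ⟨‖r‖, fun p _ => ?_⟩
    rw [Algebra.algebraMap_eq_smul_one, map_smul_eq_mul]
    have h1 := p.star_mul_self 1
    rw [star_one, one_mul] at h1
    have : p 1 ≤ 1 := by nlinarith [apply_nonneg p 1]
    exact mul_le_of_le_one_right (norm_nonneg r) this
  | gen g => exact R.bounded g
  | genStar g =>
    obtain ⟨C, hC⟩ := R.bounded g
    exact ⟨C, fun p hp => by rw [← FreeStarAlgebra.star_of, p.map_star]; exact hC p hp⟩
  | mul a b ha hb =>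
    obtain ⟨C, hC⟩ := ha
    obtain ⟨D, hD⟩ := hb
    exact ⟨C * D, fun p hp => (p.mul_le a b).trans (mul_le_mul (hC p hp) (hD p hp)
      (apply_nonneg p b) ((apply_nonneg p a).trans (hC p hp)))⟩
  | add a b ha hb =>
    obtain ⟨C, hC⟩ := ha
    obtain ⟨D, hD⟩ := hb
    exact ⟨C + D, fun p hp => (map_add_le_add p a b).trans (add_le_add (hC p hp) (hD p hp))⟩

/-- The largest C*-seminorm compatible with the relations. -/
def maxSeminorm : CStarSeminorm (FreeStarAlgebra G) :=
  CStarSeminorm.sup R.seminorms R.seminorms_nonempty R.bddAbove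

/-- The universal unital C*-algebra with the given generators and relations. -/
def Universal : Type u := R.maxSeminorm.Complete

instance : CStarAlgebra R.Universal := inferInstanceAs (CStarAlgebra R.maxSeminorm.Complete)

/-- The class of a polynomial in the universal C*-algebra. -/
def ofPoly : FreeStarAlgebra G →⋆ₐ[ℂ] R.Universal := R.maxSeminorm.toComplete

/-- The generators of the universal C*-algebra. -/
def gen (g : G) : R.Universal := R.ofPoly (FreeStarAlgebra.of g)

theorem ofPoly_eq_zero {r : FreeStarAlgebra G} (hr : r ∈ R.rel) : R.ofPoly r = 0 := by
  have : Nonempty R.seminorms := R.seminorms_nonempty.to_subtype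
  rw [← norm_eq_zero]
  refine (R.maxSeminorm.norm_toComplete r).trans ?_
  change (⨆ p : R.seminorms, p.1 r) = 0
  have h0 : (fun p : R.seminorms => p.1 r) = fun _ => 0 := funext fun p => p.2 r hr
  rw [h0, ciSup_const]

/-- The `*`-homomorphism given by the universal property. -/
def lift {B : Type v} [CStarAlgebra B] (f : G → B)
    (hf : ∀ r ∈ R.rel, FreeStarAlgebra.lift f r = 0) : R.Universal →⋆ₐ[ℂ] B :=
  R.maxSeminorm.extend (FreeStarAlgebra.lift f) fun x =>
    CStarSeminorm.le_sup R.seminorms_nonempty R.bddAbove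
      (p := CStarSeminorm.ofHom (FreeStarAlgebra.lift f))
      (fun r hr => by
        change ‖FreeStarAlgebra.lift f r‖ = 0
        rw [hf r hr, norm_zero]) x

theorem lift_ofPoly {B : Type v} [CStarAlgebra B] (f : G → B)
    (hf : ∀ r ∈ R.rel, FreeStarAlgebra.lift f r = 0) (x : FreeStarAlgebra G) :
    R.lift f hf (R.ofPoly x) = FreeStarAlgebra.lift f x :=
  R.maxSeminorm.extend_toComplete _ _ x

theorem lift_gen {B : Type v} [CStarAlgebra B] (f : G → B)
    (hf : ∀ r ∈ R.rel, FreeStarAlgebra.lift f r = 0) (g : G) :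
    R.lift f hf (R.gen g) = f g := by
  rw [gen, lift_ofPoly, FreeStarAlgebra.lift_of]

theorem hom_ext {B : Type v} [CStarAlgebra B] {φ ψ : R.Universal →⋆ₐ[ℂ] B}
    (h : ∀ g, φ (R.gen g) = ψ (R.gen g)) : φ = ψ := by
  have hx : ∀ x, φ (R.ofPoly x) = ψ (R.ofPoly x) := fun x => by
    induction x using FreeStarAlgebra.induction_on with
    | scalar r => rw [AlgHomClass.commutes R.ofPoly, AlgHomClass.commutes φ, AlgHomClass.commutes ψ]
    | gen g => exact h g
    | genStar g =>
      rw [← FreeStarAlgebra.star_of, StarHomClass.map_star R.ofPoly, StarHomClass.map_star φ,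
        StarHomClass.map_star ψ]
      exact congrArg star (h g)
    | mul a b ha hb => rw [map_mul, map_mul, map_mul, ha, hb]
    | add a b ha hb => rw [map_add, map_add, map_add, ha, hb]
  ext x
  refine R.maxSeminorm.toComplete_induction (motive := fun x => φ x = ψ x) ?_ hx x
  have h1 : Continuous φ := AddMonoidHomClass.continuous_of_bound φ 1 fun x => by
    rw [one_mul]; exact NonUnitalStarAlgHom.norm_apply_le φ x
  have h2 : Continuous ψ := AddMonoidHomClass.continuous_of_bound ψ 1 fun x => by
    rw [one_mul]; exact NonUnitalStarAlgHom.norm_apply_le ψ x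
  exact isClosed_eq h1 h2

end CStarPresentation

/-! ## Relations used below -/

section Relations

variable {G : Type u}

open FreeStarAlgebra

theorem CStarSeminorm.isometry_le_one (p : CStarSeminorm (FreeStarAlgebra G))
    {x : FreeStarAlgebra G} (h : p (star x * x - 1) = 0) : p x ≤ 1 := by
  have h1 := p.star_mul_self 1
  rw [star_one, one_mul] at h1
  have h2 : p (star x * x) ≤ p 1 := by
    have := map_add_le_add p (star x * x - 1) 1
    rwa [sub_add_cancel, h, zero_add] at this
  rw [p.star_mul_self] at h2
  have h3 : p 1 ≤ 1 := by nlinarith [apply_nonneg p 1]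
  nlinarith [apply_nonneg p x]

/-- The relations of a C*-algebra `B`, for generators `j b` indexed by the elements `b` of `B`. -/
def copyRel {B : Type v} [NonUnitalCStarAlgebra B] (j : B → G) : Set (FreeStarAlgebra G) :=
  {r | ∃ a b, r = of (j (a + b)) - (of (j a) + of (j b))} ∪
  {r | ∃ a b, r = of (j (a * b)) - of (j a) * of (j b)} ∪
  {r | ∃ (c : ℂ) (b : B), r = of (j (c • b)) - c • of (j b)} ∪
  {r | ∃ b, r = of (j (star b)) - star (of (j b))}

theorem CStarSeminorm.toComplete_eq (p : CStarSeminorm (FreeStarAlgebra G))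
    {x y : FreeStarAlgebra G} (h : p (x - y) = 0) : p.toComplete x = p.toComplete y := by
  rw [← sub_eq_zero, ← map_sub, ← norm_eq_zero, p.norm_toComplete, h]

theorem copyRel_le {B : Type v} [NonUnitalCStarAlgebra B] (j : B → G)
    (p : CStarSeminorm (FreeStarAlgebra G)) (hp : ∀ r ∈ copyRel j, p r = 0) (b : B) :
    p (of (j b)) ≤ ‖b‖ := by
  have hadd : ∀ a b, p.toComplete (of (j (a + b))) =
      p.toComplete (of (j a)) + p.toComplete (of (j b)) := fun a b => by
    rw [← map_add]
    exact p.toComplete_eq (hp _ (Or.inl (Or.inl (Or.inl ⟨a, b, rfl⟩))))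
  have hmul : ∀ a b, p.toComplete (of (j (a * b))) =
      p.toComplete (of (j a)) * p.toComplete (of (j b)) := fun a b => by
    rw [← map_mul]
    exact p.toComplete_eq (hp _ (Or.inl (Or.inl (Or.inr ⟨a, b, rfl⟩))))
  have hsmul : ∀ (c : ℂ) b, p.toComplete (of (j (c • b))) =
      c • p.toComplete (of (j b)) := fun c b => by
    rw [← map_smul]
    exact p.toComplete_eq (hp _ (Or.inl (Or.inr ⟨c, b, rfl⟩)))
  have hstar : ∀ b, p.toComplete (of (j (star b))) = star (p.toComplete (of (j b))) := fun b => by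
    rw [← StarHomClass.map_star p.toComplete]
    exact p.toComplete_eq (hp _ (Or.inr ⟨b, rfl⟩))
  let f : B →⋆ₙₐ[ℂ] p.Complete :=
    { toFun := fun b => p.toComplete (of (j b))
      map_smul' := hsmul
      map_zero' := by simpa using hsmul 0 0
      map_add' := hadd
      map_mul' := hmul
      map_star' := hstar }
  rw [← p.norm_toComplete]
  exact NonUnitalStarAlgHom.norm_apply_le f b

end Relations

/-! ## Closed two-sided ideals -/

/-- The closed two-sided ideal generated by a self-adjoint set `S`, as a C*-subalgebra. -/
def closedIdeal {A : Type u} [CStarAlgebra A] (S : Set A) (hS : ∀ x ∈ S, star x ∈ S) :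
    NonUnitalStarSubalgebra ℂ A :=
  have hstar : ∀ x ∈ TwoSidedIdeal.span S, star x ∈ TwoSidedIdeal.span S := fun x hx => by
    induction hx using TwoSidedIdeal.span_induction with
    | mem x hx => exact TwoSidedIdeal.subset_span (hS x hx)
    | zero => rw [star_zero]; exact zero_mem _
    | add x y _ _ hx hy => rw [star_add]; exact add_mem hx hy
    | neg x _ hx => rw [star_neg]; exact neg_mem hx
    | left_absorb a x _ hx => rw [star_mul]; exact TwoSidedIdeal.mul_mem_right _ _ _ hx
    | right_absorb b x _ hx => rw [star_mul]; exact TwoSidedIdeal.mul_mem_left _ _ _ hx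
  NonUnitalStarSubalgebra.topologicalClosure
    { carrier := TwoSidedIdeal.span S
      add_mem' := add_mem
      zero_mem' := zero_mem _
      mul_mem' := fun {a _} _ hb => TwoSidedIdeal.mul_mem_left _ a _ hb
      smul_mem' := fun c x hx => by
        rw [← one_mul x, ← smul_mul_assoc]; exact TwoSidedIdeal.mul_mem_left _ _ _ hx
      star_mem' := fun {x} hx => hstar x hx }

theorem coe_closedIdeal {A : Type u} [CStarAlgebra A] (S : Set A) (hS : ∀ x ∈ S, star x ∈ S) :
    (closedIdeal S hS : Set A) = closure (TwoSidedIdeal.span S : Set A) := rfl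

theorem isClosed_closedIdeal {A : Type u} [CStarAlgebra A] (S : Set A)
    (hS : ∀ x ∈ S, star x ∈ S) : IsClosed (closedIdeal S hS : Set A) := isClosed_closure

theorem mem_closedIdeal {A : Type u} [CStarAlgebra A] {S : Set A} (hS : ∀ x ∈ S, star x ∈ S)
    {x : A} (hx : x ∈ S) : x ∈ closedIdeal S hS :=
  subset_closure (TwoSidedIdeal.subset_span hx)

/-- The closed ideal generated by the defect `1 - s s*`. -/
def defectIdeal {A : Type u} [CStarAlgebra A] (s : A) : NonUnitalStarSubalgebra ℂ A :=
  closedIdeal {1 - s * star s} (by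
    rintro x rfl
    rw [Set.mem_singleton_iff, star_sub, star_one, star_mul, star_star])

/-! ## Tensor products -/

section Tensor

open FreeStarAlgebra

variable (A : Type u) (B : Type v) [CStarAlgebra A] [NonUnitalCStarAlgebra B]

/-- The universal unital C*-algebra generated by commuting copies of `A` and `B`, the unit of `A`
being the unit. -/
def commutingPresentation : CStarPresentation (A ⊕ B) where
  rel := copyRel (G := A ⊕ B) (B := A) Sum.inl ∪ {of (Sum.inl 1) - 1} ∪
    copyRel (G := A ⊕ B) (B := B) Sum.inr ∪
    {r | ∃ (a : A) (b : B), r = of (Sum.inl a) * of (Sum.inr b) - of (Sum.inr b) * of (Sum.inl a)}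
  bounded := by
    rintro (a | b)
    · exact ⟨‖a‖, fun p hp => copyRel_le _ p
        (fun r hr => hp r (Or.inl (Or.inl (Or.inl hr)))) a⟩
    · exact ⟨‖b‖, fun p hp => copyRel_le _ p
        (fun r hr => hp r (Or.inl (Or.inr hr))) b⟩

/-- The products `a b` in the universal C*-algebra generated by commuting copies of `A` and `B`. -/
def elementaryTensors : Set (commutingPresentation A B).Universal :=
  Set.range fun x : A × B =>
    (commutingPresentation A B).gen (Sum.inl x.1) * (commutingPresentation A B).gen (Sum.inr x.2)

variable {A B}

theorem commuting_gen (a : A) (b : B) :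
    (commutingPresentation A B).gen (Sum.inl a) * (commutingPresentation A B).gen (Sum.inr b) =
      (commutingPresentation A B).gen (Sum.inr b) *
        (commutingPresentation A B).gen (Sum.inl a) := by
  have h := (commutingPresentation A B).ofPoly_eq_zero (Or.inr ⟨a, b, rfl⟩)
  rw [map_sub, map_mul, map_mul, sub_eq_zero] at h
  exact h

theorem commuting_gen_star_inl (a : A) :
    (commutingPresentation A B).gen (Sum.inl (star a)) =
      star ((commutingPresentation A B).gen (Sum.inl a)) := by
  have h := (commutingPresentation A B).ofPoly_eq_zero
    (Or.inl (Or.inl (Or.inl (Or.inr ⟨a, rfl⟩))))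
  rw [map_sub, StarHomClass.map_star, sub_eq_zero] at h
  exact h

theorem commuting_gen_star_inr (b : B) :
    (commutingPresentation A B).gen (Sum.inr (star b)) =
      star ((commutingPresentation A B).gen (Sum.inr b)) := by
  have h := (commutingPresentation A B).ofPoly_eq_zero
    (Or.inl (Or.inr (Or.inr ⟨b, rfl⟩)))
  rw [map_sub, StarHomClass.map_star, sub_eq_zero] at h
  exact h

theorem star_mem_elementaryTensors (x : (commutingPresentation A B).Universal)
    (hx : x ∈ elementaryTensors A B) : star x ∈ elementaryTensors A B := by
  obtain ⟨⟨a, b⟩, rfl⟩ := hx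
  refine ⟨(star a, star b), ?_⟩
  change _ * _ = star (_ * _)
  rw [star_mul, ← commuting_gen_star_inl, ← commuting_gen_star_inr]
  exact commuting_gen (star a) (star b)

variable (A B)

/-- The (maximal) C*-tensor product `A ⊗ B` of a unital C*-algebra `A` and a C*-algebra `B`: the
closed ideal generated by all products `a b` in the universal C*-algebra generated by commuting
copies of `A` and `B`. -/
abbrev CStarTensor : NonUnitalStarSubalgebra ℂ (commutingPresentation A B).Universal :=
  closedIdeal (elementaryTensors A B) star_mem_elementaryTensors

variable {A B}

/-- The elementary tensor `a ⊗ b`. -/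
def CStarTensor.tmul (a : A) (b : B) : CStarTensor A B :=
  ⟨_, mem_closedIdeal star_mem_elementaryTensors ⟨(a, b), rfl⟩⟩

end Tensor

/-! ## The C*-algebras of the theorem -/

/-- The C*-algebra of continuous functions on the circle. -/
abbrev CircleAlgebra : Type := C(Circle, ℂ)

/-- The canonical unitary generating the continuous functions on the circle. -/
def CircleAlgebra.u : CircleAlgebra := ⟨fun z => (z : ℂ), continuous_subtype_val⟩

/-- The Hilbert space of square summable sequences. -/
abbrev EllTwo : Type := lp (fun _ : ℕ => ℂ) 2

/-- The adjoint of a compact operator is compact. -/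
theorem isCompactOperator_star {T : EllTwo →L[ℂ] EllTwo} (hT : IsCompactOperator T) :
    IsCompactOperator ⇑(star T : EllTwo →L[ℂ] EllTwo) := by
  rw [ContinuousLinearMap.star_eq_adjoint,
    isCompactOperator_iff_exists_mem_nhds_isCompact_closure_image]
  refine ⟨Metric.closedBall 0 1, Metric.closedBall_mem_nhds 0 one_pos, ?_⟩
  refine TotallyBounded.isCompact_of_isClosed (TotallyBounded.closure ?_) isClosed_closure
  have hS : IsCompactOperator ⇑(T * T.adjoint) := hT.comp_clm T.adjoint
  have hb : TotallyBounded (⇑(T * T.adjoint) '' Metric.closedBall 0 1) :=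
    (hS.isCompact_closure_image_closedBall (f := (T * T.adjoint).toLinearMap) 1).totallyBounded.subset
      subset_closure
  have key : ∀ x ∈ Metric.closedBall (0 : EllTwo) 1, ∀ y ∈ Metric.closedBall (0 : EllTwo) 1,
      ‖T.adjoint x - T.adjoint y‖ ^ 2 ≤ 2 * ‖(T * T.adjoint) x - (T * T.adjoint) y‖ := by
    intro x hx y hy
    rw [mem_closedBall_zero_iff] at hx hy
    rw [← map_sub, ← map_sub, ← inner_self_eq_norm_sq (𝕜 := ℂ), ContinuousLinearMap.adjoint_inner_left]
    refine (RCLike.re_le_norm _).trans ((norm_inner_le_norm _ _).trans ?_)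
    exact mul_le_mul_of_nonneg_right ((norm_sub_le x y).trans (by linarith)) (norm_nonneg _)
  rw [Metric.totallyBounded_iff]
  intro ε hε
  obtain ⟨t, hts, htf, ht⟩ := Metric.finite_approx_of_totallyBounded hb (ε ^ 2 / 2) (by positivity)
  have hts' : ∀ z ∈ t, ∃ x, x ∈ Metric.closedBall (0 : EllTwo) 1 ∧ (T * T.adjoint) x = z :=
    fun z hz => hts hz
  choose! g hg hgt using hts'
  refine ⟨(fun z => T.adjoint (g z)) '' t, htf.image _, ?_⟩
  rintro _ ⟨x, hx, rfl⟩
  obtain ⟨z, hz, hxz⟩ := Set.mem_iUnion₂.1 (ht ⟨x, hx, rfl⟩)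
  refine Set.mem_iUnion₂.2 ⟨_, ⟨z, hz, rfl⟩, ?_⟩
  rw [Metric.mem_ball, dist_eq_norm] at hxz ⊢
  have h1 := key x hx (g z) (hg z hz)
  rw [hgt z hz] at h1
  exact lt_of_pow_lt_pow_left₀ 2 hε.le (by linarith)

/-- The C*-algebra of compact operators on the separable infinite dimensional Hilbert space. -/
def Compacts : NonUnitalStarSubalgebra ℂ (EllTwo →L[ℂ] EllTwo) where
  carrier := {T | IsCompactOperator T}
  add_mem' hS hT := hS.add hT
  zero_mem' := isCompactOperator_zero
  mul_mem' {S _} _ hT := hT.clm_comp S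
  smul_mem' c _ hT := hT.smul c
  star_mem' hT := isCompactOperator_star hT

instance : NonUnitalCStarAlgebra Compacts :=
  haveI : IsClosed (Compacts : Set (EllTwo →L[ℂ] EllTwo)) := isClosed_setOfPred_isCompactOperator
  NonUnitalStarSubalgebra.nonUnitalCStarAlgebra Compacts

/-- The standard orthonormal basis. -/
def stdBasis (i : ℕ) : EllTwo := lp.single 2 i 1

/-- The rank one partial isometry mapping the basis vector `e 0` to `e i`. -/
def Compacts.x (i : ℕ) : Compacts :=
  ⟨InnerProductSpace.rankOne ℂ (stdBasis i) (stdBasis 0), by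
    change IsCompactOperator (fun y => inner ℂ (stdBasis 0) y • stdBasis i)
    exact (isCompactOperator_id (E := ℂ)).comp_clm (innerSL ℂ (stdBasis 0)) |>.clm_comp
      (ContinuousLinearMap.toSpanSingleton ℂ (stdBasis i))⟩

open FreeStarAlgebra in
/-- The universal C*-algebra generated by an isometry. -/
def toeplitzPresentation : CStarPresentation Unit where
  rel := {star (of ()) * of () - 1}
  bounded _ := ⟨1, fun p hp => p.isometry_le_one (hp _ rfl)⟩

/-- The Toeplitz algebra. -/
abbrev Toeplitz : Type := toeplitzPresentation.Universal

/-- The isometry generating the Toeplitz algebra. -/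
def Toeplitz.v : Toeplitz := toeplitzPresentation.gen ()

theorem Toeplitz.star_v_mul_v : star Toeplitz.v * Toeplitz.v = 1 := by
  have h := toeplitzPresentation.ofPoly_eq_zero rfl
  rw [map_sub, map_mul, StarHomClass.map_star, map_one, sub_eq_zero] at h
  exact h

/-- The endomorphism `v ↦ z v` of the Toeplitz algebra. -/
def Toeplitz.rotateHom (z : Circle) : Toeplitz →⋆ₐ[ℂ] Toeplitz :=
  toeplitzPresentation.lift (fun _ => (z : ℂ) • Toeplitz.v) (by
    rintro r rfl
    have hz : star (z : ℂ) * (z : ℂ) = 1 := by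
      
      change (starRingEnd ℂ) (z : ℂ) * (z : ℂ) = 1
      rw [Complex.conj_mul', Circle.norm_coe, Complex.ofReal_one, one_pow]
    rw [map_sub, map_mul, StarHomClass.map_star, FreeStarAlgebra.lift_of, map_one, star_smul,
      smul_mul_smul_comm, Toeplitz.star_v_mul_v, hz, one_smul, sub_self])

theorem Toeplitz.rotateHom_v (z : Circle) :
    Toeplitz.rotateHom z Toeplitz.v = (z : ℂ) • Toeplitz.v :=
  toeplitzPresentation.lift_gen _ _ ()

theorem Toeplitz.rotateHom_comp (z w : Circle) (h : w * z = 1) :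
    (Toeplitz.rotateHom z).comp (Toeplitz.rotateHom w) = StarAlgHom.id ℂ Toeplitz := by
  refine toeplitzPresentation.hom_ext fun _ => ?_
  change Toeplitz.rotateHom z (Toeplitz.rotateHom w Toeplitz.v) = Toeplitz.v
  rw [rotateHom_v, map_smul, rotateHom_v, smul_smul, ← Circle.coe_mul, h, Circle.coe_one, one_smul]

/-- The automorphism `v ↦ z v` of the Toeplitz algebra. -/
def Toeplitz.rotate (z : Circle) : Toeplitz ≃⋆ₐ[ℂ] Toeplitz :=
  StarAlgEquiv.ofStarAlgHom (Toeplitz.rotateHom z) (Toeplitz.rotateHom z⁻¹)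
    (Toeplitz.rotateHom_comp _ _ (mul_inv_cancel z)) (Toeplitz.rotateHom_comp _ _ (inv_mul_cancel z))

section Crossed

open FreeStarAlgebra

variable {A : Type u} [CStarAlgebra A]

/-- The presentation of the crossed product of a unital C*-algebra `A` by an automorphism `α`: a
copy of `A` (with the same unit) together with a unitary `u` such that `u a u* = α a`. -/
def crossedPresentation (α : A ≃⋆ₐ[ℂ] A) : CStarPresentation (A ⊕ Unit) where
  rel := copyRel (G := A ⊕ Unit) (B := A) Sum.inl ∪ {of (Sum.inl 1) - 1} ∪
    {star (of (Sum.inr ())) * of (Sum.inr ()) - 1, of (Sum.inr ()) * star (of (Sum.inr ())) - 1} ∪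
    {r | ∃ a, r = of (Sum.inr ()) * of (Sum.inl a) * star (of (Sum.inr ())) - of (Sum.inl (α a))}
  bounded := by
    rintro (a | ⟨⟩)
    · exact ⟨‖a‖, fun p hp => copyRel_le _ p
        (fun r hr => hp r (Or.inl (Or.inl (Or.inl hr)))) a⟩
    · exact ⟨1, fun p hp => p.isometry_le_one (hp _ (Or.inl (Or.inr (Or.inl rfl))))⟩

/-- The crossed product of `A` by the integers acting through the powers of `α`. -/
abbrev CrossedProduct (α : A ≃⋆ₐ[ℂ] A) : Type u := (crossedPresentation α).Universal

end Crossed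

/-- The scalar `exp (2 π i θ)`. -/
def twist (θ : ℝ) : Circle := Circle.exp (2 * Real.pi * θ)

/-- The crossed product of the Toeplitz algebra by the automorphism `v ↦ exp (2 π i θ) v`. -/
abbrev ToeplitzCrossed (θ : ℝ) : Type := CrossedProduct (Toeplitz.rotate (twist θ))

/-- The unitary implementing the automorphism. -/
def ToeplitzCrossed.u (θ : ℝ) : ToeplitzCrossed θ := (crossedPresentation _).gen (Sum.inr ())

/-- The canonical image of the isometry generating the Toeplitz algebra. -/
def ToeplitzCrossed.v (θ : ℝ) : ToeplitzCrossed θ := (crossedPresentation _).gen (Sum.inl Toeplitz.v)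

/-- Names of the two generators of the tensor twist. -/
inductive TwistGen : Type
  | u
  | v

open FreeStarAlgebra in
/-- Two isometries `u`, `v` such that `u* v = conj (exp (2 π i θ)) v u*`. -/
def tensorTwistPresentation (θ : ℝ) : CStarPresentation TwistGen where
  rel := {star (of .u) * of .u - 1, star (of .v) * of .v - 1,
    star (of .u) * of .v - star (twist θ : ℂ) • (of .v * star (of .u))}
  bounded
    | .u => ⟨1, fun p hp => p.isometry_le_one (hp _ (Or.inl rfl))⟩
    | .v => ⟨1, fun p hp => p.isometry_le_one (hp _ (Or.inr (Or.inl rfl)))⟩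

/-- The tensor twist of two isometries. -/
abbrev TensorTwist (θ : ℝ) : Type := (tensorTwistPresentation θ).Universal

/-- The first generating isometry. -/
def TensorTwist.u (θ : ℝ) : TensorTwist θ := (tensorTwistPresentation θ).gen .u

/-- The second generating isometry. -/
def TensorTwist.v (θ : ℝ) : TensorTwist θ := (tensorTwistPresentation θ).gen .v

end

noncomputable section

open scoped InnerProductSpace
open MulOpposite

/-! All three isomorphisms are instances of one principle. Let `s` be an isometry in `D` and `p = 1
- s s*`, and let `L : A → D` be a homomorphism from an algebra `A` generated by one element `w`,
with `L w * s = μ • (s * L w)` and `star (L w) * s = star μ • (s * star (L w))`. Then `L a` commutes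
with `p`, and `L a * s ^ i = s ^ i * L (β i a)`, where `β i` rotates `w` by `μ ^ i`. If moreover `s`
and `L w` generate `D`, the closed ideal generated by `p` is the closed span of the entries `s ^ i p
L(a) s* ^ j`. It therefore consists of infinite matrices over `L(A) p`, with matrix units `s ^ i p
s* ^ j`.

The product `A ⊗ K` is a closed span of the same kind, with columns `1 ⊗ x i` and corner `a ↦ a ⊗ x
0`. Both are cases of `IsStabilization`: a column family together with an isometric representation
of `A` on its corner, whose entries span densely. Two stabilizations of the same `A` are isomorphic
by matching entries (`IsStabilization.equiv`). On a finite corner the matching is a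
`*`-homomorphism, hence contractive, so it passes to the limit; exchanging the two algebras gives
the inverse.

The point that needs a construction is that `a ↦ L a * p` is isometric. It is settled by a
representation on the standard Hilbert module of sequences in `A`: `s` acts as the shift and `L w`
as the diagonal operator with entries `β i w = μ ^ i • w`. The vector with entry `1` in place `0`
then recovers `‖a‖` (`norm_le_norm_diagHom_mul`). Constant diagonals do the same for `A ⊗ K`.

For the crossed product, `A = C(S^1)`, `w = u`, `s = v`. For the tensor twist, `A` is the Toeplitz
algebra, and `s` is `v` or `u`, with the twist inverted in the second case. There `L w * s = μ • (s
* L w)` is not among the defining relations; it follows from them by the C*-identity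
(`mul_eq_of_star_mul_eq`). -/

instance {A : Type*} [CStarAlgebra A] : CStarAlgebra Aᵐᵒᵖ where
  norm_mul_self_le x := by
    rw [← norm_unop (star x * x), unop_mul, unop_star, CStarRing.norm_self_mul_star, norm_unop]

/-! ### The standard Hilbert module and its adjointable operators -/

namespace StandardModule

variable {A : Type*} [CStarAlgebra A]

instance : PartialOrder Aᵐᵒᵖ := CStarAlgebra.spectralOrder _
instance : StarOrderedRing Aᵐᵒᵖ := CStarAlgebra.spectralOrderedRing _

/-- The inner product of finitely supported sequences in `A`, antilinear in the first variable. -/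
def innerProd (x y : ℕ →₀ A) : Aᵐᵒᵖ := op (x.sum fun i a => star a * y i)

theorem innerProd_eq_sum {x : ℕ →₀ A} (y : ℕ →₀ A) {s : Finset ℕ} (hs : x.support ⊆ s) :
    innerProd x y = ∑ i ∈ s, op (star (x i) * y i) := by
  rw [innerProd, Finsupp.sum_of_support_subset x hs _ (by simp), Finset.op_sum]

instance : Norm (ℕ →₀ A) := ⟨fun x => √‖innerProd x x‖⟩

/-- Scalars from `A` act on the right, which is a left action of `Aᵐᵒᵖ`; multiplying entries on the
left then commutes with it. Positivity comes from `op (star a * a) = op a * star (op a)`. The module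
need not be complete, since only operator norms on it are used. -/
instance : CStarModule Aᵐᵒᵖ (ℕ →₀ A) where
  inner := innerProd
  inner_add_right {x y z} := by
    rw [innerProd_eq_sum _ subset_rfl, innerProd_eq_sum _ subset_rfl, innerProd_eq_sum _ subset_rfl,
      ← Finset.sum_add_distrib]
    simp [mul_add]
  inner_self_nonneg {x} := by
    rw [innerProd_eq_sum _ subset_rfl]
    exact Finset.sum_nonneg fun i _ => by
      simp [mul_star_self_nonneg (op (x i))]
  inner_self {x} := by
    refine ⟨fun h => ?_, fun h => by rw [h]; rfl⟩
    rw [innerProd_eq_sum _ subset_rfl,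
      Finset.sum_eq_zero_iff_of_nonneg fun i _ => by
        simp [mul_star_self_nonneg (op (x i))]] at h
    ext i
    by_cases hi : i ∈ x.support
    · simpa using h i hi
    · simpa using hi
  inner_op_smul_right {a x y} := by
    rw [innerProd_eq_sum _ subset_rfl, innerProd_eq_sum _ subset_rfl, Finset.mul_sum]
    exact Finset.sum_congr rfl fun i _ => by simp [← mul_assoc]
  inner_smul_right_complex {z x y} := by
    rw [innerProd_eq_sum _ subset_rfl, innerProd_eq_sum _ subset_rfl, Finset.smul_sum]
    exact Finset.sum_congr rfl fun i _ => by simp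
  star_inner x y := by
    rw [innerProd_eq_sum y (Finset.subset_union_left (s₂ := y.support)),
      innerProd_eq_sum x (Finset.subset_union_right (s₁ := x.support)), star_sum]
    exact Finset.sum_congr rfl fun i _ => by simp [← op_star]
  norm_eq_sqrt_norm_inner_self x := rfl

theorem inner_eq_sum {x : ℕ →₀ A} (y : ℕ →₀ A) {s : Finset ℕ} (hs : x.support ⊆ s) :
    ⟪x, y⟫_(Aᵐᵒᵖ) = ∑ i ∈ s, op (star (x i) * y i) := innerProd_eq_sum y hs

theorem inner_single_left (i : ℕ) (a : A) (y : ℕ →₀ A) :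
    ⟪Finsupp.single i a, y⟫_(Aᵐᵒᵖ) = op (star a * y i) := by
  change op ((Finsupp.single i a).sum fun i a => star a * y i) = _
  rw [Finsupp.sum_single_index (by simp)]

instance : NormedAddCommGroup (ℕ →₀ A) := CStarModule.normedAddCommGroup Aᵐᵒᵖ

instance : NormedSpace ℂ (ℕ →₀ A) := .ofCore (CStarModule.normedSpaceCore Aᵐᵒᵖ)

theorem norm_single (i : ℕ) (a : A) : ‖Finsupp.single i a‖ = ‖a‖ := by
  rw [CStarModule.norm_eq_sqrt_norm_inner_self (A := Aᵐᵒᵖ), inner_single_left,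
    Finsupp.single_eq_same, norm_op, CStarRing.norm_star_mul_self, Real.sqrt_mul_self (norm_nonneg a)]

/-- Two linear maps on the module are adjoint if they agree with this on the standard vectors. -/
theorem inner_adjoint_of_single {S T : (ℕ →₀ A) →ₗ[ℂ] (ℕ →₀ A)}
    (h : ∀ i a j b, ⟪S (.single i a), Finsupp.single j b⟫_(Aᵐᵒᵖ) =
      ⟪Finsupp.single i a, T (.single j b)⟫_(Aᵐᵒᵖ)) (x y : ℕ →₀ A) :
    ⟪S x, y⟫_(Aᵐᵒᵖ) = ⟪x, T y⟫_(Aᵐᵒᵖ) := by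
  induction x using Finsupp.induction_linear with
  | zero => simp
  | add x x' hx hx' => rw [map_add, CStarModule.inner_add_left, CStarModule.inner_add_left, hx, hx']
  | single i a =>
    induction y using Finsupp.induction_linear with
    | zero => simp
    | add y y' hy hy' =>
      rw [map_add, CStarModule.inner_add_right, CStarModule.inner_add_right, hy, hy']
    | single j b => exact h i a j b

variable (A) in
/-- An adjointable operator on the finitely supported sequences in `A`. -/
structure Adjointable where
  toCLM : (ℕ →₀ A) →L[ℂ] (ℕ →₀ A)
  adj : (ℕ →₀ A) →L[ℂ] (ℕ →₀ A)
  inner_eq : ∀ x y, ⟪toCLM x, y⟫_(Aᵐᵒᵖ) = ⟪x, adj y⟫_(Aᵐᵒᵖ)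

/-- A linear map with an adjoint, bounded on the diagonal. -/
def Adjointable.mk' (S T : (ℕ →₀ A) →ₗ[ℂ] (ℕ →₀ A))
    (h : ∀ x y, ⟪S x, y⟫_(Aᵐᵒᵖ) = ⟪x, T y⟫_(Aᵐᵒᵖ)) (C : ℝ) (hC : ∀ x, ‖S x‖ ≤ C * ‖x‖) :
    Adjointable A where
  toCLM := S.mkContinuous C hC
  adj := T.mkContinuous C fun x => by
    -- Cauchy–Schwarz for `⟪T x, T x⟫ = ⟪S (T x), x⟫` gives the adjoint the same bound `C`. The sign
    -- of `C` is not assumed, so the case `‖T x‖ = 0` is treated separately.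
    have h1 : ‖T x‖ ^ 2 ≤ C * ‖T x‖ * ‖x‖ := by
      rw [CStarModule.norm_sq_eq Aᵐᵒᵖ, ← h]
      exact (CStarModule.norm_inner_le (ℕ →₀ A)).trans
        (mul_le_mul_of_nonneg_right (hC (T x)) (norm_nonneg x))
    rcases (norm_nonneg (T x)).eq_or_lt with h0 | h0
    · rw [← h0]
      rcases (norm_nonneg x).eq_or_lt with hx | hx
      · rw [← hx, mul_zero]
      · have := (norm_nonneg _).trans (hC x)
        exact this
    · nlinarith
  inner_eq := h

open FreeStarAlgebra in
/-- The action of polynomials in adjointable operators. -/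
def evalPoly : FreeStarAlgebra (Adjointable A) →ₐ[ℂ] ((ℕ →₀ A) →L[ℂ] (ℕ →₀ A)) :=
  liftAlg Adjointable.toCLM Adjointable.adj

theorem inner_evalPoly (p : FreeStarAlgebra (Adjointable A)) (x y : ℕ →₀ A) :
    ⟪evalPoly p x, y⟫_(Aᵐᵒᵖ) = ⟪x, evalPoly (star p) y⟫_(Aᵐᵒᵖ) := by
  induction p using FreeStarAlgebra.induction_on generalizing x y with
  | scalar r =>
    rw [FreeStarAlgebra.star_scalar, AlgHom.commutes, AlgHom.commutes]
    simp [Algebra.algebraMap_eq_smul_one]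
  | gen g =>
    rw [FreeStarAlgebra.star_of, evalPoly, FreeStarAlgebra.liftAlg_of,
      FreeStarAlgebra.liftAlg_ofStar]
    exact g.inner_eq x y
  | genStar g =>
    rw [FreeStarAlgebra.star_ofStar, evalPoly, FreeStarAlgebra.liftAlg_of,
      FreeStarAlgebra.liftAlg_ofStar, ← CStarModule.star_inner, ← g.inner_eq,
      CStarModule.star_inner]
  | mul a b ha hb =>
    rw [map_mul, star_mul, map_mul, mul_apply_eq_comp, mul_apply_eq_comp,
      ha, hb]
  | add a b ha hb =>
    rw [map_add, star_add, map_add, add_apply, add_apply,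
      CStarModule.inner_add_left, CStarModule.inner_add_right, ha, hb]

/-- By adjointness `‖p x‖ ^ 2 = ‖⟪x, p* p x⟫‖`, and Cauchy–Schwarz bounds this by `‖p* p‖ ‖x‖ ^ 2`.
This is the half of the C*-identity that does not follow from submultiplicativity. -/
theorem norm_evalPoly_sq_le (p : FreeStarAlgebra (Adjointable A)) :
    ‖evalPoly p‖ ^ 2 ≤ ‖evalPoly (star p * p)‖ := by
  have h : ‖evalPoly p‖ ≤ √‖evalPoly (star p * p)‖ := by
    refine ContinuousLinearMap.opNorm_le_bound _ (Real.sqrt_nonneg _) fun x => ?_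
    refine le_of_sq_le_sq ?_ (by positivity)
    rw [mul_pow, Real.sq_sqrt (norm_nonneg _), CStarModule.norm_sq_eq Aᵐᵒᵖ, inner_evalPoly,
      ← mul_apply_eq_comp, ← map_mul, sq]
    refine (CStarModule.norm_inner_le (ℕ →₀ A)).trans ?_
    nlinarith [norm_nonneg x, (evalPoly (star p * p)).le_opNorm x]
  exact (Real.le_sqrt (norm_nonneg _) (norm_nonneg _)).1 h

theorem norm_evalPoly_le_star (p : FreeStarAlgebra (Adjointable A)) :
    ‖evalPoly p‖ ≤ ‖evalPoly (star p)‖ := by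
  have h := norm_evalPoly_sq_le p
  rw [map_mul] at h
  have h' := h.trans (norm_mul_le _ _)
  rcases (norm_nonneg (evalPoly p)).eq_or_lt with h0 | h0
  · rw [← h0]; exact norm_nonneg _
  · nlinarith

variable (A) in
/-- The operator norm as a C*-seminorm. -/
def opSeminorm : CStarSeminorm (FreeStarAlgebra (Adjointable A)) where
  toFun p := ‖evalPoly p‖
  map_zero' := by simp
  add_le' x y := by rw [map_add]; exact norm_add_le _ _
  neg' x := by rw [map_neg, norm_neg]
  smul' r x := by rw [map_smul, norm_smul]
  mul_le' x y := by rw [map_mul]; exact norm_mul_le _ _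
  star_mul_self' x := by
    refine le_antisymm ?_ (norm_evalPoly_sq_le x)
    rw [map_mul, sq]
    refine (norm_mul_le _ _).trans (mul_le_mul_of_nonneg_right ?_ (norm_nonneg _))
    simpa using norm_evalPoly_le_star (star x)

variable (A) in
/-- The C*-algebra generated by the adjointable operators on the standard Hilbert module. -/
abbrev Operators : Type _ := (opSeminorm A).Complete

/-- An adjointable operator as an element of the C*-algebra. -/
def Adjointable.toOp (T : Adjointable A) : Operators A :=
  (opSeminorm A).toComplete (FreeStarAlgebra.of T)

/-- The seminorm of a polynomial is the norm of the operator it defines, so it vanishes only with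
that operator. Identities in `Operators A` between polynomials can thus be checked on vectors
`single i a`. -/
theorem toComplete_eq_iff {p q : FreeStarAlgebra (Adjointable A)} :
    (opSeminorm A).toComplete p = (opSeminorm A).toComplete q ↔ evalPoly p = evalPoly q := by
  rw [← sub_eq_zero, ← map_sub, ← norm_eq_zero, (opSeminorm A).norm_toComplete]
  change ‖evalPoly (p - q)‖ = 0 ↔ _
  rw [norm_eq_zero, map_sub, sub_eq_zero]

theorem evalPoly_of (T : Adjointable A) : evalPoly (FreeStarAlgebra.of T) = T.toCLM :=
  FreeStarAlgebra.liftAlg_of _ _ _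

theorem evalPoly_star_of (T : Adjointable A) : evalPoly (star (FreeStarAlgebra.of T)) = T.adj := by
  rw [FreeStarAlgebra.star_of]; exact FreeStarAlgebra.liftAlg_ofStar _ _ _

/-- The shift of the finitely supported sequences. -/
def shiftLin : (ℕ →₀ A) →ₗ[ℂ] (ℕ →₀ A) := Finsupp.lsum ℂ fun i => Finsupp.lsingle (i + 1)

/-- The backward shift of the finitely supported sequences. -/
def backwardShiftLin : (ℕ →₀ A) →ₗ[ℂ] (ℕ →₀ A) :=
  Finsupp.lsum ℂ fun | 0 => 0 | i + 1 => Finsupp.lsingle i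

/-- The diagonal operator with entries `c i`. -/
def diagLin (c : ℕ → A) : (ℕ →₀ A) →ₗ[ℂ] (ℕ →₀ A) :=
  Finsupp.lsum ℂ fun i => Finsupp.lsingle i ∘ₗ LinearMap.mulLeft ℂ (c i)

@[simp] theorem shiftLin_single (i : ℕ) (a : A) :
    shiftLin (.single i a) = Finsupp.single (i + 1) a := by simp [shiftLin]

@[simp] theorem backwardShiftLin_single_zero (a : A) :
    backwardShiftLin (.single 0 a) = 0 := by simp [backwardShiftLin]

@[simp] theorem backwardShiftLin_single_succ (i : ℕ) (a : A) :
    backwardShiftLin (.single (i + 1) a) = Finsupp.single i a := by simp [backwardShiftLin]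

@[simp] theorem diagLin_single (c : ℕ → A) (i : ℕ) (a : A) :
    diagLin c (.single i a) = Finsupp.single i (c i * a) := by simp [diagLin]

theorem diagLin_apply (c : ℕ → A) (x : ℕ →₀ A) (i : ℕ) : diagLin c x i = c i * x i := by
  induction x using Finsupp.induction_linear with
  | zero => simp
  | add x y hx hy => simp [hx, hy, mul_add]
  | single j a =>
    rw [diagLin_single]
    by_cases h : j = i
    · subst h; simp
    · simp [h]

theorem inner_shiftLin (x y : ℕ →₀ A) :
    ⟪shiftLin x, y⟫_(Aᵐᵒᵖ) = ⟪x, backwardShiftLin y⟫_(Aᵐᵒᵖ) := by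
  refine inner_adjoint_of_single (fun i a j b => ?_) x y
  rw [shiftLin_single, inner_single_left, inner_single_left]
  cases j with
  | zero => simp
  | succ j => simp [Finsupp.single_apply]

theorem inner_diagLin (c : ℕ → A) (x y : ℕ →₀ A) :
    ⟪diagLin c x, y⟫_(Aᵐᵒᵖ) = ⟪x, diagLin (fun i => star (c i)) y⟫_(Aᵐᵒᵖ) := by
  refine inner_adjoint_of_single (fun i a j b => ?_) x y
  rw [diagLin_single, inner_single_left, inner_single_left, diagLin_apply, star_mul, mul_assoc]

theorem backwardShiftLin_shiftLin (x : ℕ →₀ A) : backwardShiftLin (shiftLin x) = x := by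
  induction x using Finsupp.induction_linear with
  | zero => simp
  | add x y hx hy => simp [hx, hy]
  | single j a => simp

/-- The bound holds at the level of `A`-valued inner products: entrywise `x* (c* c) x ≤ C ^ 2 • x*
x`. Norms are monotone on positive elements. -/
theorem norm_diagLin_le (c : ℕ → A) {C : ℝ} (h0 : 0 ≤ C) (hc : ∀ i, ‖c i‖ ≤ C) (x : ℕ →₀ A) :
    ‖diagLin c x‖ ≤ C * ‖x‖ := by
  refine le_of_sq_le_sq ?_ (by positivity)
  have hs : (diagLin c x).support ⊆ x.support := fun i hi => by
    rw [Finsupp.mem_support_iff, diagLin_apply] at hi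
    exact Finsupp.mem_support_iff.2 (right_ne_zero_of_mul hi)
  have h : ⟪diagLin c x, diagLin c x⟫_(Aᵐᵒᵖ) ≤ (C ^ 2) • ⟪x, x⟫_(Aᵐᵒᵖ) := by
    rw [inner_eq_sum _ hs, inner_eq_sum x subset_rfl, Finset.smul_sum]
    refine Finset.sum_le_sum fun i _ => ?_
    have h1 : op (star (diagLin c x i) * diagLin c x i) =
        op (x i) * op (star (c i) * c i) * star (op (x i)) := by
      rw [diagLin_apply]; simp [mul_assoc]
    have h2 : op (star (x i) * x i) = op (x i) * star (op (x i)) := by simp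
    rw [h1, h2]
    have h3 : IsSelfAdjoint (op (star (c i) * c i)) := by
      rw [IsSelfAdjoint, ← op_star]; simp
    refine (CStarAlgebra.star_right_conjugate_le_norm_smul (hb := h3)).trans ?_
    have h4 : ‖op (star (c i) * c i)‖ ≤ C ^ 2 := by
      rw [norm_op, CStarRing.norm_star_mul_self, sq]
      exact mul_le_mul (hc i) (hc i) (norm_nonneg _) h0
    exact smul_le_smul_of_nonneg_right h4 (mul_star_self_nonneg _)
  rw [mul_pow, CStarModule.norm_sq_eq Aᵐᵒᵖ, CStarModule.norm_sq_eq Aᵐᵒᵖ]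
  refine (CStarAlgebra.norm_le_norm_of_nonneg_of_le (ha := CStarModule.inner_self_nonneg) h).trans ?_
  rw [norm_smul, Real.norm_of_nonneg (sq_nonneg C)]

end StandardModule

end

/-! ### The shift and the diagonal representations -/

noncomputable section

open scoped InnerProductSpace
open MulOpposite

namespace StandardModule

variable {A : Type*} [CStarAlgebra A]

theorem clm_ext {S T : (ℕ →₀ A) →L[ℂ] (ℕ →₀ A)}
    (h : ∀ i a, S (Finsupp.single i a) = T (Finsupp.single i a)) : S = T := by
  ext1 x
  induction x using Finsupp.induction_linear with
  | zero => rw [map_zero, map_zero]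
  | add x y hx hy => rw [map_add, map_add, hx, hy]
  | single i a => exact h i a

variable (A) in
/-- The shift as an adjointable operator. -/
def shiftAdjointable : Adjointable A :=
  .mk' shiftLin backwardShiftLin inner_shiftLin 1 fun x => by
    rw [CStarModule.norm_eq_sqrt_norm_inner_self (A := Aᵐᵒᵖ), inner_shiftLin,
      backwardShiftLin_shiftLin, ← CStarModule.norm_eq_sqrt_norm_inner_self (A := Aᵐᵒᵖ), one_mul]

variable (A) in
/-- The shift. -/
def shift : Operators A := (shiftAdjointable A).toOp

/-- The diagonal operator with entries `β i a`. -/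
def diagAdjointable (β : ℕ → A →⋆ₐ[ℂ] A) (a : A) : Adjointable A :=
  .mk' (diagLin fun i => β i a) _ (inner_diagLin _) ‖a‖
    (norm_diagLin_le _ (norm_nonneg a) fun i => NonUnitalStarAlgHom.norm_apply_le (β i) a)

theorem shiftAdjointable_toCLM_single (i : ℕ) (a : A) :
    (shiftAdjointable A).toCLM (.single i a) = Finsupp.single (i + 1) a := shiftLin_single i a

theorem shiftAdjointable_adj_single_zero (a : A) :
    (shiftAdjointable A).adj (.single 0 a) = 0 := backwardShiftLin_single_zero a

theorem shiftAdjointable_adj_single_succ (i : ℕ) (a : A) :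
    (shiftAdjointable A).adj (.single (i + 1) a) = Finsupp.single i a :=
  backwardShiftLin_single_succ i a

theorem diagAdjointable_toCLM_single (β : ℕ → A →⋆ₐ[ℂ] A) (a : A) (i : ℕ) (b : A) :
    (diagAdjointable β a).toCLM (.single i b) = Finsupp.single i (β i a * b) :=
  diagLin_single _ i b

theorem diagAdjointable_adj_single (β : ℕ → A →⋆ₐ[ℂ] A) (a : A) (i : ℕ) (b : A) :
    (diagAdjointable β a).adj (.single i b) = Finsupp.single i (star (β i a) * b) :=
  diagLin_single _ i b

theorem star_shift_mul_shift : star (shift A) * shift A = 1 := by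
  rw [shift, Adjointable.toOp, ← StarHomClass.map_star, ← map_mul, ← map_one (opSeminorm A).toComplete,
    toComplete_eq_iff, map_mul, map_one, evalPoly_of, evalPoly_star_of]
  refine clm_ext fun i a => ?_
  rw [mul_apply_eq_comp, shiftAdjointable_toCLM_single, shiftAdjointable_adj_single_succ]
  rfl

/-- The representation of `A` by diagonal operators with entries `β i a`. -/
def diagHom (β : ℕ → A →⋆ₐ[ℂ] A) : A →⋆ₐ[ℂ] Operators A where
  toFun a := (diagAdjointable β a).toOp
  map_one' := by
    rw [Adjointable.toOp, ← map_one (opSeminorm A).toComplete, toComplete_eq_iff, evalPoly_of,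
      map_one]
    refine clm_ext fun i b => ?_
    rw [diagAdjointable_toCLM_single, map_one, one_mul]
    rfl
  map_mul' a b := by
    rw [Adjointable.toOp, Adjointable.toOp, Adjointable.toOp, ← map_mul, toComplete_eq_iff, map_mul,
      evalPoly_of, evalPoly_of, evalPoly_of]
    refine clm_ext fun i c => ?_
    rw [mul_apply_eq_comp, diagAdjointable_toCLM_single, diagAdjointable_toCLM_single,
      diagAdjointable_toCLM_single, map_mul, mul_assoc]
  map_zero' := by
    rw [Adjointable.toOp, ← map_zero (opSeminorm A).toComplete, toComplete_eq_iff, evalPoly_of,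
      map_zero]
    refine clm_ext fun i b => ?_
    rw [diagAdjointable_toCLM_single, map_zero, zero_mul, Finsupp.single_zero]
    rfl
  map_add' a b := by
    rw [Adjointable.toOp, Adjointable.toOp, Adjointable.toOp, ← map_add, toComplete_eq_iff, map_add,
      evalPoly_of, evalPoly_of, evalPoly_of]
    refine clm_ext fun i c => ?_
    rw [add_apply, diagAdjointable_toCLM_single, diagAdjointable_toCLM_single,
      diagAdjointable_toCLM_single, map_add, add_mul, Finsupp.single_add]
  commutes' r := by
    rw [Adjointable.toOp, ← AlgHomClass.commutes (opSeminorm A).toComplete, toComplete_eq_iff,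
      evalPoly_of, AlgHomClass.commutes evalPoly]
    refine clm_ext fun i b => ?_
    rw [diagAdjointable_toCLM_single, AlgHomClass.commutes, ← Algebra.smul_def,
      ← Finsupp.smul_single, Algebra.algebraMap_eq_smul_one]
    rfl
  map_star' a := by
    rw [Adjointable.toOp, Adjointable.toOp, ← StarHomClass.map_star, toComplete_eq_iff,
      evalPoly_of, evalPoly_star_of]
    refine clm_ext fun i b => ?_
    rw [diagAdjointable_toCLM_single, diagAdjointable_adj_single, StarHomClass.map_star]

/-- The shift moves place `i` to place `i + 1`, so the two products differ by the ratio of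
consecutive diagonal entries. This realises the twisted commutation relation on the module. -/
theorem diagHom_mul_shift {β : ℕ → A →⋆ₐ[ℂ] A} {a : A} {μ : ℂ}
    (h : ∀ i, β (i + 1) a = μ • β i a) :
    diagHom β a * shift A = μ • (shift A * diagHom β a) := by
  change Adjointable.toOp _ * _ = μ • (_ * Adjointable.toOp _)
  rw [shift, Adjointable.toOp, Adjointable.toOp, ← map_mul, ← map_mul, ← map_smul,
    toComplete_eq_iff, map_mul, map_smul, map_mul, evalPoly_of, evalPoly_of]
  refine clm_ext fun i b => ?_
  rw [smul_apply, mul_apply_eq_comp, mul_apply_eq_comp, diagAdjointable_toCLM_single,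
    shiftAdjointable_toCLM_single, shiftAdjointable_toCLM_single, diagAdjointable_toCLM_single, h,
    smul_mul_assoc, Finsupp.smul_single]

/-- The defect projection of the shift fixes the vector `single 0 1`, and the diagonal operator
sends it to `single 0 a`, of norm `‖a‖`. Every isometry statement for corner representations below
rests on this. -/
theorem norm_le_norm_diagHom_mul {β : ℕ → A →⋆ₐ[ℂ] A} (a : A) (h : β 0 a = a) :
    ‖a‖ ≤ ‖diagHom β a * (1 - shift A * star (shift A))‖ := by
  change _ ≤ ‖Adjointable.toOp _ * _‖
  rw [shift, Adjointable.toOp, Adjointable.toOp, ← StarHomClass.map_star, ← map_mul,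
    ← map_one (opSeminorm A).toComplete, ← map_sub, ← map_mul, (opSeminorm A).norm_toComplete]
  set q : FreeStarAlgebra (Adjointable A) := _
  change _ ≤ ‖evalPoly q‖
  have hq : evalPoly q (.single 0 1) = Finsupp.single 0 a := by
    rw [map_mul, map_sub, map_one, map_mul, evalPoly_of, evalPoly_of, evalPoly_star_of,
      mul_apply_eq_comp, sub_apply, mul_apply_eq_comp, shiftAdjointable_adj_single_zero, map_zero,
      sub_zero]
    change (diagAdjointable β a).toCLM (.single 0 1) = _
    rw [diagAdjointable_toCLM_single, h, mul_one]
  calc ‖a‖ = ‖evalPoly q (.single 0 1)‖ := by rw [hq, norm_single]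
    _ ≤ ‖evalPoly q‖ * ‖Finsupp.single 0 (1 : A)‖ := (evalPoly q).le_opNorm _
    _ ≤ ‖evalPoly q‖ * 1 := by
        rw [norm_single]
        gcongr
        rcases subsingleton_or_nontrivial A with hA | hA
        · rw [Subsingleton.elim (1 : A) 0, norm_zero]; exact zero_le_one
        · rw [CStarRing.norm_one]
    _ = ‖evalPoly q‖ := mul_one _

end StandardModule

end

/-! ### Column families, stabilizations and matrix coefficients -/

noncomputable section

open Filter Topology

/-- A representation `ρ` of `A` together with partial isometries `x i` having orthogonal ranges
and initial projection `x 0`, which acts as a unit on the range of `ρ`. -/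
structure IsColumnFamily {A B : Type*} [NonUnitalCStarAlgebra A] [NonUnitalCStarAlgebra B]
    (ρ : A →⋆ₙₐ[ℂ] B) (x : ℕ → B) : Prop where
  star_mul_col : ∀ i j, star (x i) * x j = if i = j then x 0 else 0
  map_mul_col_zero : ∀ a, ρ a * x 0 = ρ a

namespace IsColumnFamily

variable {A B : Type*} [NonUnitalCStarAlgebra A] [NonUnitalCStarAlgebra B]
  {ρ : A →⋆ₙₐ[ℂ] B} {x : ℕ → B} (h : IsColumnFamily ρ x)

include h

theorem star_mul_self (i : ℕ) : star (x i) * x i = x 0 := by rw [h.star_mul_col, if_pos rfl]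

theorem star_col_zero : star (x 0) = x 0 := by
  rw [← h.star_mul_self 0, star_mul, star_star]

theorem col_zero_mul_col_zero : x 0 * x 0 = x 0 := by
  nth_rw 1 [← h.star_col_zero]
  exact h.star_mul_self 0

/-- By the C*-identity it suffices that `star y * y = 0` for `y = x i * x 0 - x i`. Each of the four
terms of the expansion is `x 0` up to sign, and the signs cancel. -/
theorem col_mul_col_zero (i : ℕ) : x i * x 0 = x i := by
  rw [← sub_eq_zero, ← CStarRing.star_mul_self_eq_zero_iff]
  simp only [star_sub, star_mul, h.star_col_zero, sub_mul, mul_sub]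
  rw [← mul_assoc (star (x i)), mul_assoc (x 0) (star (x i)), ← mul_assoc (star (x i)),
    h.star_mul_self, h.col_zero_mul_col_zero, h.col_zero_mul_col_zero, mul_assoc, h.star_mul_self, h.col_zero_mul_col_zero]
  abel

theorem col_zero_mul_star (i : ℕ) : x 0 * star (x i) = star (x i) := by
  rw [← h.star_col_zero, ← star_mul, h.col_mul_col_zero]

theorem col_zero_mul_map (a : A) : x 0 * ρ a = ρ a := by
  rw [← h.star_col_zero, ← star_star (ρ a), ← star_mul, ← map_star, h.map_mul_col_zero]

theorem star_mul_entry (k i : ℕ) (a : A) (c : B) :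
    star (x k) * (x i * ρ a * c) = if k = i then ρ a * c else 0 := by
  rw [mul_assoc, ← mul_assoc, h.star_mul_col]
  split_ifs
  · rw [← mul_assoc, h.col_zero_mul_map]
  · rw [zero_mul]

theorem entry_mul_col (c : B) (a : A) (j l : ℕ) :
    c * ρ a * star (x j) * x l = if j = l then c * ρ a else 0 := by
  rw [mul_assoc, h.star_mul_col]
  split_ifs
  · rw [mul_assoc, h.map_mul_col_zero]
  · rw [mul_zero]

theorem entry_mul_entry (i j k l : ℕ) (a b : A) :
    x i * ρ a * star (x j) * (x k * ρ b * star (x l)) =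
      if j = k then x i * ρ (a * b) * star (x l) else 0 := by
  rw [← mul_assoc, ← mul_assoc, h.entry_mul_col]
  split_ifs
  · rw [mul_assoc (x i), map_mul]
  · rw [zero_mul, zero_mul]

end IsColumnFamily

/-- The sum of the first `n` range projections. -/
def colProj {B : Type*} [NonUnitalCStarAlgebra B] (x : ℕ → B) (n : ℕ) : B :=
  ∑ i ∈ Finset.range n, x i * star (x i)

theorem star_colProj {B : Type*} [NonUnitalCStarAlgebra B] (x : ℕ → B) (n : ℕ) :
    star (colProj x n) = colProj x n := by
  rw [colProj, star_sum]
  exact Finset.sum_congr rfl fun i _ => by rw [star_mul, star_star]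

namespace IsColumnFamily

variable {A B : Type*} [NonUnitalCStarAlgebra A] [NonUnitalCStarAlgebra B]
  {ρ : A →⋆ₙₐ[ℂ] B} {x : ℕ → B} (h : IsColumnFamily ρ x)

include h

theorem star_mul_colProj (i n : ℕ) :
    star (x i) * colProj x n = if i < n then star (x i) else 0 := by
  rw [colProj, Finset.mul_sum]
  simp only [← mul_assoc, h.star_mul_col, ite_mul, zero_mul, h.col_zero_mul_star]
  simp

theorem colProj_mul_col (i n : ℕ) : colProj x n * x i = if i < n then x i else 0 := by
  rw [← star_star (colProj x n * x i), star_mul, star_colProj, h.star_mul_colProj]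
  split_ifs <;> simp

theorem colProj_mul_self (n : ℕ) : colProj x n * colProj x n = colProj x n := by
  conv_lhs => enter [2]; rw [colProj]
  rw [Finset.mul_sum, colProj]
  refine Finset.sum_congr rfl fun i hi => ?_
  rw [← mul_assoc, ← colProj, h.colProj_mul_col, if_pos (Finset.mem_range.1 hi)]

theorem norm_colProj_le (n : ℕ) : ‖colProj x n‖ ≤ 1 := by
  have h1 := CStarRing.norm_star_mul_self (x := colProj x n)
  rw [star_colProj, h.colProj_mul_self] at h1
  nlinarith [norm_nonneg (colProj x n)]

end IsColumnFamily

/-- `B` is the stabilization of `A`: the entries `x i * ρ a * star (x j)` span a dense subspace. -/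
structure IsStabilization {A B : Type*} [NonUnitalCStarAlgebra A] [NonUnitalCStarAlgebra B]
    (ρ : A →⋆ₙₐ[ℂ] B) (x : ℕ → B) : Prop extends IsColumnFamily ρ x where
  norm_map : ∀ a, ‖ρ a‖ = ‖a‖
  dense : (Submodule.span ℂ
    {b | ∃ i a j, b = x i * ρ a * star (x j)}).topologicalClosure = ⊤

namespace IsStabilization

variable {A B C : Type*} [NonUnitalCStarAlgebra A] [NonUnitalCStarAlgebra B]
  [NonUnitalCStarAlgebra C] {ρ : A →⋆ₙₐ[ℂ] B} {x : ℕ → B} (h : IsStabilization ρ x)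

include h

/-- Density of the entries, as an induction principle for closed linear properties. -/
theorem mem_of_isClosed (M : Submodule ℂ B) (hM : IsClosed (M : Set B))
    (hx : ∀ i a j, x i * ρ a * star (x j) ∈ M) (b : B) : b ∈ M := by
  have h1 : (Submodule.span ℂ
      {b | ∃ i a j, b = x i * ρ a * star (x j)}).topologicalClosure ≤ M :=
    Submodule.topologicalClosure_minimal _
      (Submodule.span_le.2 (by rintro _ ⟨i, a, j, rfl⟩; exact hx i a j)) hM
  rw [h.dense] at h1
  exact h1 trivial

theorem isometry : Isometry ρ := AddMonoidHomClass.isometry_of_norm ρ h.norm_map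

theorem injective : Function.Injective ρ := h.isometry.injective

/-- The compression `b ↦ star (x i) * b * x j` sends entries into the range of `ρ`. That range is
closed because `ρ` is isometric, so it receives all of `B`. -/
theorem exists_coef (i j : ℕ) (b : B) : ∃ a, ρ a = star (x i) * b * x j := by
  let L : B →L[ℂ] B := (ContinuousLinearMap.mul ℂ B).flip (x j) ∘L
    ContinuousLinearMap.mul ℂ B (star (x i))
  let R : Submodule ℂ B := LinearMap.range (ρ : A →ₗ[ℂ] B)
  have hR : IsClosed (R : Set B) := h.isometry.isClosedEmbedding.isClosed_range
  refine h.mem_of_isClosed (R.comap (L : B →ₗ[ℂ] B)) (hR.preimage L.continuous) ?_ b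
  intro k a l
  change star (x i) * (x k * ρ a * star (x l)) * x j ∈ R
  rw [h.star_mul_entry]
  split_ifs
  · rw [mul_assoc, h.star_mul_col]
    split_ifs
    · rw [h.map_mul_col_zero]; exact ⟨a, rfl⟩
    · rw [mul_zero]; exact zero_mem _
  · rw [zero_mul]; exact zero_mem _

omit h in
/-- The `(i, j)` matrix coefficient of an element of the stabilization. -/
def coef (h : IsStabilization ρ x) (i j : ℕ) (b : B) : A := (h.exists_coef i j b).choose

theorem map_coef (i j : ℕ) (b : B) : ρ (h.coef i j b) = star (x i) * b * x j :=
  (h.exists_coef i j b).choose_spec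

theorem coef_eq {i j : ℕ} {b : B} {a : A} (ha : ρ a = star (x i) * b * x j) : h.coef i j b = a :=
  h.injective ((h.map_coef i j b).trans ha.symm)

theorem coef_add (i j : ℕ) (b c : B) : h.coef i j (b + c) = h.coef i j b + h.coef i j c :=
  h.coef_eq (by rw [map_add, map_coef, map_coef, mul_add, add_mul])

theorem coef_smul (i j : ℕ) (r : ℂ) (b : B) : h.coef i j (r • b) = r • h.coef i j b :=
  h.coef_eq (by rw [map_smul, map_coef, mul_smul_comm, smul_mul_assoc])

theorem coef_star (i j : ℕ) (b : B) : h.coef i j (star b) = star (h.coef j i b) :=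
  h.coef_eq (by rw [map_star, map_coef, star_mul, star_mul, star_star, mul_assoc])

theorem coef_colProj_mul {i n : ℕ} (j : ℕ) (b : B) :
    h.coef i j (colProj x n * b) = if i < n then h.coef i j b else 0 := by
  refine h.coef_eq ?_
  rw [← mul_assoc, h.star_mul_colProj]
  split_ifs
  · rw [map_coef]
  · rw [map_zero, zero_mul, zero_mul]

theorem coef_mul_colProj {j n : ℕ} (i : ℕ) (b : B) :
    h.coef i j (b * colProj x n) = if j < n then h.coef i j b else 0 := by
  refine h.coef_eq ?_
  rw [← mul_assoc, mul_assoc, h.colProj_mul_col]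
  split_ifs
  · rw [map_coef]
  · rw [map_zero, mul_zero]

/-- Matrix multiplication truncated at `n`: stopping the sum there amounts to inserting the
projection `colProj x n` between the factors. -/
theorem sum_coef_mul_coef (i l n : ℕ) (b c : B) :
    ∑ j ∈ Finset.range n, h.coef i j b * h.coef j l c = h.coef i l (b * colProj x n * c) := by
  symm
  refine h.coef_eq ?_
  rw [map_sum, colProj, Finset.mul_sum, Finset.sum_mul, Finset.mul_sum, Finset.sum_mul]
  refine Finset.sum_congr rfl fun j _ => ?_
  rw [map_mul, map_coef, map_coef]
  simp only [mul_assoc]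

theorem coef_entry (k l i j : ℕ) (a : A) :
    h.coef k l (x i * ρ a * star (x j)) = if k = i ∧ j = l then a else 0 := by
  refine h.coef_eq ?_
  rw [h.star_mul_entry]
  split_ifs with h1 h2 h2
  · rw [mul_assoc, h.star_mul_col, if_pos h1.2, h.map_mul_col_zero]
  · exact absurd h1.1 h2
  · rw [mul_assoc, h.star_mul_col, if_neg fun h3 => h1 ⟨h2, h3⟩, map_zero, mul_zero]
  · rw [map_zero, zero_mul]

/-- On an entry with row index `i` the sequence is constant once `n > i`. The set of `b` with
convergence is a closed subspace, because the projections are uniformly bounded by `1`. -/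
theorem tendsto_colProj_mul (b : B) : Tendsto (fun n => colProj x n * b) atTop (𝓝 b) := by
  suffices hb : b ∈ {b : B | Tendsto (fun n => colProj x n * b) atTop (𝓝 b)} from hb
  let M : Submodule ℂ B :=
    { carrier := {b : B | Tendsto (fun n => colProj x n * b) atTop (𝓝 b)}
      add_mem' := fun {a b} ha hb => by
        simpa only [Set.mem_ofPred_eq, mul_add] using Tendsto.add ha hb
      zero_mem' := by simp
      smul_mem' := fun c b hb => by
        simpa only [Set.mem_ofPred_eq, mul_smul_comm] using Tendsto.const_smul hb c }
  refine h.mem_of_isClosed M ?_ ?_ b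
  · rw [← isSeqClosed_iff_isClosed]
    intro u b hu hub
    change Tendsto _ _ _
    rw [Metric.tendsto_atTop]
    intro ε hε
    obtain ⟨k, hk⟩ := ((Metric.tendsto_atTop.1 hub) (ε / 3) (by positivity))
    obtain ⟨N, hN⟩ := Metric.tendsto_atTop.1 (show Tendsto _ _ _ from hu k) (ε / 3) (by positivity)
    refine ⟨N, fun n hn => ?_⟩
    have h1 := hN n hn
    have h2 := hk k le_rfl
    rw [dist_eq_norm] at h1 h2 ⊢
    have h3 : colProj x n * b - b =
        - (colProj x n * (u k - b)) + (colProj x n * u k - u k) + (u k - b) := by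
      rw [mul_sub]; abel
    have h4 : ‖colProj x n * (u k - b)‖ ≤ ‖u k - b‖ :=
      (norm_mul_le _ _).trans (mul_le_of_le_one_left (norm_nonneg _) (h.norm_colProj_le n))
    rw [h3]
    refine (norm_add₃_le).trans_lt ?_
    rw [norm_neg]
    linarith
  · intro i a j
    refine tendsto_const_nhds.congr' ?_
    filter_upwards [eventually_gt_atTop i] with n hn
    rw [← mul_assoc, ← mul_assoc, h.colProj_mul_col, if_pos hn]

theorem tendsto_mul_colProj (b : B) : Tendsto (fun n => b * colProj x n) atTop (𝓝 b) := by
  have h1 := (h.tendsto_colProj_mul (star b)).star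
  simpa only [star_mul, star_colProj, star_star] using h1

theorem tendsto_cut (b : B) :
    Tendsto (fun n => colProj x n * b * colProj x n) atTop (𝓝 b) := by
  rw [tendsto_iff_norm_sub_tendsto_zero]
  have h1 := (tendsto_iff_norm_sub_tendsto_zero.1 (h.tendsto_mul_colProj b)).add
    (tendsto_iff_norm_sub_tendsto_zero.1 (h.tendsto_colProj_mul b))
  rw [add_zero] at h1
  refine squeeze_zero (fun _ => norm_nonneg _) (fun n => ?_) h1
  have h2 : colProj x n * b * colProj x n - b =
      colProj x n * (b * colProj x n - b) + (colProj x n * b - b) := by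
    rw [mul_sub, mul_assoc]; abel
  rw [h2]
  refine (norm_add_le _ _).trans (add_le_add_left ((norm_mul_le _ _).trans
    (mul_le_of_le_one_left (norm_nonneg _) (h.norm_colProj_le n))) _)

end IsStabilization

end

/-! ### Uniqueness of the stabilization -/

noncomputable section

open Filter Topology

namespace IsStabilization

variable {A B C : Type*} [NonUnitalCStarAlgebra A] [NonUnitalCStarAlgebra B]
  [NonUnitalCStarAlgebra C] {ρ : A →⋆ₙₐ[ℂ] B} {x : ℕ → B} (h : IsStabilization ρ x)
  {σ : A →⋆ₙₐ[ℂ] C} {y : ℕ → C} (k : IsColumnFamily σ y)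

variable (σ y) in
/-- The map sending the entries of the `n`-th corner of `B` to the corresponding entries in `C`. -/
def cutMap (n : ℕ) (b : B) : C :=
  ∑ i ∈ Finset.range n, ∑ j ∈ Finset.range n, y i * σ (h.coef i j b) * star (y j)

theorem cutMap_add (n : ℕ) (b c : B) :
    h.cutMap σ y n (b + c) = h.cutMap σ y n b + h.cutMap σ y n c := by
  simp only [cutMap, h.coef_add, map_add, mul_add, add_mul, Finset.sum_add_distrib]

theorem cutMap_smul (n : ℕ) (r : ℂ) (b : B) :
    h.cutMap σ y n (r • b) = r • h.cutMap σ y n b := by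
  simp only [cutMap, h.coef_smul, map_smul, mul_smul_comm, smul_mul_assoc, Finset.smul_sum]

theorem cutMap_star (n : ℕ) (b : B) : h.cutMap σ y n (star b) = star (h.cutMap σ y n b) := by
  simp only [cutMap, star_sum, star_mul, star_star, h.coef_star, map_star]
  rw [Finset.sum_comm]
  simp only [mul_assoc]

theorem cutMap_sub (n : ℕ) (b c : B) :
    h.cutMap σ y n (b - c) = h.cutMap σ y n b - h.cutMap σ y n c := by
  rw [eq_sub_iff_add_eq, ← cutMap_add, sub_add_cancel]

include k in
-- The matrix units of `C` multiply as those of `B`, so only the truncated matrix product appears.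
-- Hence `cutMap` is multiplicative on the `n`-th corner, where `colProj x n` acts as a unit, and
-- only there in general can the projection be dropped.
theorem cutMap_mul (n : ℕ) (b c : B) :
    h.cutMap σ y n b * h.cutMap σ y n c = h.cutMap σ y n (b * colProj x n * c) := by
  simp only [cutMap, ← h.sum_coef_mul_coef, map_sum, Finset.sum_mul, Finset.mul_sum,
    k.entry_mul_entry, Finset.sum_ite_eq']
  rw [Finset.sum_congr rfl fun i hi => by
    rw [Finset.sum_comm, Finset.sum_congr rfl fun p _ => Finset.sum_congr rfl fun l _ =>
      if_pos hi], Finset.sum_comm]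
  exact Finset.sum_congr rfl fun p _ => Finset.sum_comm

theorem cutMap_cut {m n : ℕ} (hmn : m ≤ n) (b : B) :
    h.cutMap σ y n (colProj x m * b * colProj x m) = h.cutMap σ y m b := by
  simp only [cutMap, h.coef_mul_colProj, h.coef_colProj_mul]
  have hs : Finset.range m ⊆ Finset.range n := Finset.range_mono hmn
  rw [← Finset.sum_subset hs]
  · refine Finset.sum_congr rfl fun i hi => ?_
    rw [← Finset.sum_subset hs]
    · refine Finset.sum_congr rfl fun j hj => ?_
      rw [if_pos (Finset.mem_range.1 hj), if_pos (Finset.mem_range.1 hi)]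
    · intro j _ hj
      rw [if_neg (by simpa using hj), map_zero, mul_zero, zero_mul]
  · intro i _ hi
    refine Finset.sum_eq_zero fun j _ => ?_
    have hi' : ¬i < m := by simpa using hi
    rw [if_neg hi', ite_self, map_zero, mul_zero, zero_mul]

theorem cutMap_entry {n i j : ℕ} (hi : i < n) (hj : j < n) (a : A) :
    h.cutMap σ y n (x i * ρ a * star (x j)) = y i * σ a * star (y j) := by
  simp only [cutMap, h.coef_entry]
  rw [Finset.sum_eq_single_of_mem i (Finset.mem_range.2 hi),
    Finset.sum_eq_single_of_mem j (Finset.mem_range.2 hj), if_pos ⟨rfl, rfl⟩]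
  · intro l _ hl
    rw [if_neg fun h => hl h.2.symm, map_zero, mul_zero, zero_mul]
  · intro l _ hl
    refine Finset.sum_eq_zero fun j _ => ?_
    rw [if_neg fun h => hl h.1, map_zero, mul_zero, zero_mul]

/-- The corner of `B` cut out by the `n`-th projection. -/
def corner (_h : IsStabilization ρ x) (n : ℕ) : NonUnitalStarSubalgebra ℂ B where
  carrier := {b | colProj x n * b = b ∧ b * colProj x n = b}
  add_mem' := fun {a b} ha hb => ⟨by rw [mul_add, ha.1, hb.1], by rw [add_mul, ha.2, hb.2]⟩
  zero_mem' := ⟨mul_zero _, zero_mul _⟩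
  mul_mem' := fun {a b} ha hb => ⟨by rw [← mul_assoc, ha.1], by rw [mul_assoc, hb.2]⟩
  smul_mem' := fun c a ha => ⟨by rw [mul_smul_comm, ha.1], by rw [smul_mul_assoc, ha.2]⟩
  star_mem' := fun {a} ha => ⟨by rw [← star_colProj, ← star_mul, ha.2],
    by rw [← star_colProj, ← star_mul, ha.1]⟩

theorem isClosed_corner (n : ℕ) : IsClosed (h.corner n : Set B) :=
  (isClosed_eq (continuous_const_mul _) continuous_id).inter
    (isClosed_eq (continuous_mul_const _) continuous_id)

include k in
-- On the corner `cutMap` is a `*`-homomorphism of C*-algebras, hence contractive. For general `b`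
-- it takes the same value at the cut of `b` to the corner, whose norm is at most `‖b‖`.
theorem norm_cutMap_le (n : ℕ) (b : B) : ‖h.cutMap σ y n b‖ ≤ ‖b‖ := by
  -- Closedness makes the corner a C*-algebra, so that automatic contractivity applies.
  have := h.isClosed_corner n
  let f : h.corner n →⋆ₙₐ[ℂ] C :=
    { toFun := fun b => h.cutMap σ y n b
      map_smul' := fun r b => h.cutMap_smul n r b
      map_zero' := by simpa using h.cutMap_smul (σ := σ) (y := y) n 0 0
      map_add' := fun b c => h.cutMap_add n b c
      map_mul' := fun b c => by
        change h.cutMap σ y n ((b : B) * c) = _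
        rw [h.cutMap_mul k, b.2.2]
      map_star' := fun b => h.cutMap_star n b }
  have hp := h.norm_colProj_le n
  have hmem : colProj x n * b * colProj x n ∈ h.corner n :=
    ⟨by rw [← mul_assoc, ← mul_assoc, h.colProj_mul_self], by rw [mul_assoc, h.colProj_mul_self]⟩
  have hf := NonUnitalStarAlgHom.norm_apply_le f ⟨_, hmem⟩
  change ‖h.cutMap σ y n (colProj x n * b * colProj x n)‖ ≤ ‖colProj x n * b * colProj x n‖ at hf
  rw [h.cutMap_cut le_rfl] at hf
  refine hf.trans ((norm_mul_le _ _).trans ((mul_le_of_le_one_right (norm_nonneg _) hp).trans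
    ((norm_mul_le _ _).trans (mul_le_of_le_one_left (norm_nonneg _) hp))))

include k in
-- For `m ≤ n` the `m`-th value is the `n`-th map applied to the `m`-th cut of `b`. Contractivity
-- bounds the difference by the distance from `b` to that cut, which tends to `0`.
theorem cauchySeq_cutMap (b : B) : CauchySeq fun n => h.cutMap σ y n b := by
  refine cauchySeq_of_le_tendsto_0' (fun m => ‖b - colProj x m * b * colProj x m‖)
    (fun m n hmn => ?_) ?_
  · rw [dist_comm, dist_eq_norm, ← h.cutMap_cut hmn, ← cutMap_sub]
    exact h.norm_cutMap_le k n _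
  · have h1 := tendsto_iff_norm_sub_tendsto_zero.1 (h.tendsto_cut b)
    simpa only [norm_sub_rev] using h1

/-- The limit of the maps between the corners. -/
def extFun (b : B) : C := (cauchySeq_tendsto_of_complete (h.cauchySeq_cutMap k b)).choose

theorem tendsto_cutMap (b : B) : Tendsto (fun n => h.cutMap σ y n b) atTop (𝓝 (h.extFun k b)) :=
  (cauchySeq_tendsto_of_complete (h.cauchySeq_cutMap k b)).choose_spec

/-- The homomorphism from the stabilization of `A` determined by a representation of `A` and
partial isometries. -/
def ext : B →⋆ₙₐ[ℂ] C where
  toFun := h.extFun k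
  map_smul' r b := by
    refine tendsto_nhds_unique (h.tendsto_cutMap k (r • b)) ?_
    simp only [cutMap_smul]
    exact (h.tendsto_cutMap k b).const_smul r
  map_zero' := by
    refine tendsto_nhds_unique (h.tendsto_cutMap k 0) ?_
    have h0 : ∀ n, h.cutMap σ y n 0 = 0 := fun n => by
      simpa using h.cutMap_smul (σ := σ) (y := y) n 0 0
    simp only [h0]
    exact tendsto_const_nhds
  map_add' b c := by
    refine tendsto_nhds_unique (h.tendsto_cutMap k (b + c)) ?_
    simp only [cutMap_add]
    exact (h.tendsto_cutMap k b).add (h.tendsto_cutMap k c)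
  map_mul' b c := by
    -- The product of the approximations is the approximation of `b * colProj x n * c`. By
    -- contractivity, replacing this by `b * c` costs at most `‖b * colProj x n * c - b * c‖`, which
    -- tends to `0`.
    have h1 := (h.tendsto_cutMap k b).mul (h.tendsto_cutMap k c)
    simp only [h.cutMap_mul k] at h1
    refine tendsto_nhds_unique ?_ h1
    have h2 : Tendsto (fun n => h.cutMap σ y n (b * colProj x n * c) - h.cutMap σ y n (b * c))
        atTop (𝓝 0) := by
      have h3 : Tendsto (fun n => b * (colProj x n * c) - b * c) atTop (𝓝 0) := by
        simpa using ((h.tendsto_colProj_mul c).const_mul b).sub_const (b * c)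
      refine squeeze_zero_norm (fun n => ?_) (by simpa using h3.norm)
      rw [← cutMap_sub, mul_assoc]
      exact h.norm_cutMap_le k n _
    simpa using h2.add (h.tendsto_cutMap k (b * c))
  map_star' b := by
    refine tendsto_nhds_unique (h.tendsto_cutMap k (star b)) ?_
    simp only [cutMap_star]
    exact (h.tendsto_cutMap k b).star

theorem ext_entry (i j : ℕ) (a : A) :
    h.ext k (x i * ρ a * star (x j)) = y i * σ a * star (y j) := by
  refine tendsto_nhds_unique (h.tendsto_cutMap k _) (tendsto_const_nhds.congr' ?_)
  filter_upwards [eventually_gt_atTop i, eventually_gt_atTop j] with n hi hj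
  rw [h.cutMap_entry hi hj]

/-- This is the entry with column index `0`: there `star (x 0) = x 0` is absorbed by `ρ a`, and
likewise for `y` and `σ`. -/
theorem ext_col_mul (i : ℕ) (a : A) : h.ext k (x i * ρ a) = y i * σ a := by
  have h1 := h.ext_entry k i 0 a
  rwa [h.star_col_zero, k.star_col_zero, mul_assoc, mul_assoc, h.map_mul_col_zero,
    k.map_mul_col_zero] at h1

include h in
theorem hom_ext {f g : B →⋆ₙₐ[ℂ] C}
    (hfg : ∀ i a j, f (x i * ρ a * star (x j)) = g (x i * ρ a * star (x j))) : f = g := by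
  have hf : Continuous f := AddMonoidHomClass.continuous_of_bound f 1 fun x => by
    rw [one_mul]; exact NonUnitalStarAlgHom.norm_apply_le f x
  have hg : Continuous g := AddMonoidHomClass.continuous_of_bound g 1 fun x => by
    rw [one_mul]; exact NonUnitalStarAlgHom.norm_apply_le g x
  ext b
  exact h.mem_of_isClosed (LinearMap.eqLocus (f : B →ₗ[ℂ] C) (g : B →ₗ[ℂ] C))
    (isClosed_eq hf hg) hfg b

/-- Two stabilizations of the same algebra are isomorphic. -/
def equiv (k : IsStabilization σ y) : B ≃⋆ₐ[ℂ] C :=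
  have h1 : (k.ext h.toIsColumnFamily).comp (h.ext k.toIsColumnFamily) =
      NonUnitalStarAlgHom.id ℂ B := h.hom_ext fun i a j => by
    rw [NonUnitalStarAlgHom.comp_apply, h.ext_entry, k.ext_entry]; rfl
  have h2 : (h.ext k.toIsColumnFamily).comp (k.ext h.toIsColumnFamily) =
      NonUnitalStarAlgHom.id ℂ C := k.hom_ext fun i a j => by
    rw [NonUnitalStarAlgHom.comp_apply, k.ext_entry, h.ext_entry]; rfl
  { h.ext k.toIsColumnFamily with
    invFun := k.ext h.toIsColumnFamily
    left_inv := DFunLike.congr_fun h1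
    right_inv := DFunLike.congr_fun h2
    map_smul' := map_smul (h.ext k.toIsColumnFamily) }

theorem equiv_col_mul (k : IsStabilization σ y) (i : ℕ) (a : A) :
    h.equiv k (x i * ρ a) = y i * σ a := h.ext_col_mul k.toIsColumnFamily i a

end IsStabilization

end

/-! ### Topological generation, closed ideals and defect projections -/

noncomputable section

open Filter Topology

theorem starAlgHom_continuous {A B : Type*} [CStarAlgebra A] [CStarAlgebra B] (f : A →⋆ₐ[ℂ] B) :
    Continuous f :=
  AddMonoidHomClass.continuous_of_bound f 1 fun x => by
    rw [one_mul]; exact NonUnitalStarAlgHom.norm_apply_le f x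

/-- The only closed subalgebra containing `S` and the adjoints of its elements is everything. -/
def IsTopGenerating {A : Type*} [CStarAlgebra A] (S : Set A) : Prop :=
  ∀ M : Subalgebra ℂ A, IsClosed (M : Set A) → (∀ s ∈ S, s ∈ M ∧ star s ∈ M) → ∀ a, a ∈ M

namespace IsTopGenerating

variable {A B : Type*} [CStarAlgebra A] [CStarAlgebra B] {S : Set A} (hS : IsTopGenerating S)

include hS

theorem hom_ext {f g : A →⋆ₐ[ℂ] B} (h : ∀ s ∈ S, f s = g s) : f = g := by
  ext a
  refine hS (AlgHom.equalizer (f : A →ₐ[ℂ] B) (g : A →ₐ[ℂ] B))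
    (isClosed_eq (starAlgHom_continuous f) (starAlgHom_continuous g)) (fun s hs => ⟨h s hs, ?_⟩) a
  change f (star s) = g (star s)
  rw [map_star, map_star, h s hs]

theorem trans {T : Set B} (f : A →⋆ₐ[ℂ] B) (hT : IsTopGenerating (Set.range f ∪ T)) :
    IsTopGenerating (f '' S ∪ T) := by
  intro M hM h
  refine hT M hM ?_
  have hf : ∀ a, f a ∈ M := hS (M.comap (f : A →ₐ[ℂ] B)) (hM.preimage (starAlgHom_continuous f))
    fun s hs => ⟨(h _ (Or.inl ⟨s, hs, rfl⟩)).1, by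
      change f (star s) ∈ M
      rw [map_star]
      exact (h _ (Or.inl ⟨s, hs, rfl⟩)).2⟩
  rintro s (⟨a, rfl⟩ | hs)
  · exact ⟨hf a, by rw [← map_star]; exact hf _⟩
  · exact h s (Or.inr hs)

/-- The elements that multiply `Z` into itself form a closed subalgebra, so it is enough to test
generators and their adjoints. -/
theorem mul_mem_of_isClosed (Z : Submodule ℂ A) (hZ : IsClosed (Z : Set A))
    (h : ∀ s ∈ S, ∀ z ∈ Z, s * z ∈ Z ∧ star s * z ∈ Z) (a : A) {z : A} (hz : z ∈ Z) :
    a * z ∈ Z := by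
  let M : Subalgebra ℂ A :=
    { carrier := {a | ∀ z ∈ Z, a * z ∈ Z}
      mul_mem' := fun {a b} ha hb z hz => by rw [mul_assoc]; exact ha _ (hb z hz)
      add_mem' := fun {a b} ha hb z hz => by rw [add_mul]; exact add_mem (ha z hz) (hb z hz)
      algebraMap_mem' := fun r z hz => by
        rw [← Algebra.smul_def]; exact Z.smul_mem r hz }
  have hM : IsClosed (M : Set A) := by
    have : (M : Set A) = ⋂ z ∈ Z, (fun a => a * z) ⁻¹' Z := by
      ext a; simp only [Set.mem_iInter]; rfl
    rw [this]
    exact isClosed_biInter fun z _ => hZ.preimage (continuous_mul_const z)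
  exact hS M hM (fun s hs => ⟨fun z hz => (h s hs z hz).1, fun z hz => (h s hs z hz).2⟩) a z hz

/-- A closed ideal is contained in every self-adjoint closed subspace that contains its generators
and is stable under left multiplication by the generators of the algebra. -/
theorem closedIdeal_subset {E : Set A} {hE : ∀ x ∈ E, star x ∈ E} {T : Set A}
    (hT : ∀ t ∈ T, star t ∈ T)
    (h : ∀ s ∈ S, ∀ t ∈ T, s * t ∈ (Submodule.span ℂ T).topologicalClosure ∧
      star s * t ∈ (Submodule.span ℂ T).topologicalClosure)
    (hET : E ⊆ (Submodule.span ℂ T).topologicalClosure) :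
    (closedIdeal E hE : Set A) ⊆ (Submodule.span ℂ T).topologicalClosure := by
  set Z := (Submodule.span ℂ T).topologicalClosure with hZdef
  have hZ : IsClosed (Z : Set A) := Submodule.isClosed_topologicalClosure _
  have hle : ∀ W : Submodule ℂ A, IsClosed (W : Set A) → T ⊆ W → Z ≤ W := fun W hW hTW =>
    Submodule.topologicalClosure_minimal _ (Submodule.span_le.2 hTW) hW
  have hmul : ∀ b : A, (∀ t ∈ T, b * t ∈ Z) → ∀ z ∈ Z, b * z ∈ Z := fun b hb z hz =>
    hle (Z.comap (LinearMap.mulLeft ℂ b)) (hZ.preimage (continuous_const_mul b)) hb hz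
  have hleft : ∀ a : A, ∀ z ∈ Z, a * z ∈ Z := fun a z hz =>
    hS.mul_mem_of_isClosed Z hZ (fun s hs z hz => ⟨hmul s (fun t ht => (h s hs t ht).1) z hz,
      hmul _ (fun t ht => (h s hs t ht).2) z hz⟩) a hz
  have hstar : ∀ z ∈ Z, star z ∈ Z := by
    let W : Submodule ℂ A :=
      { carrier := {z | star z ∈ Z}
        add_mem' := fun {a b} ha hb => by
          change star (a + b) ∈ Z
          rw [star_add]; exact add_mem ha hb
        zero_mem' := by
          change star (0 : A) ∈ Z
          rw [star_zero]; exact zero_mem _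
        smul_mem' := fun c a ha => by
          change star (c • a) ∈ Z
          rw [star_smul]; exact Z.smul_mem _ ha }
    exact fun z hz => hle W (hZ.preimage continuous_star)
      (fun t ht => Submodule.le_topologicalClosure _ (Submodule.subset_span (hT t ht))) hz
  -- Stability on the right follows from stability on the left by taking adjoints, since `Z` is
  -- self-adjoint.
  have hright : ∀ a : A, ∀ z ∈ Z, z * a ∈ Z := fun a z hz => by
    rw [← star_star (z * a), star_mul]
    exact hstar _ (hleft _ _ (hstar z hz))
  rw [coe_closedIdeal]
  refine closure_minimal (fun x hx => ?_) hZ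
  change x ∈ TwoSidedIdeal.span E at hx
  induction hx using TwoSidedIdeal.span_induction with
  | mem x hx => exact hET hx
  | zero => exact zero_mem Z
  | add x y _ _ hx hy => exact add_mem hx hy
  | neg x _ hx => exact neg_mem hx
  | left_absorb a x _ hx => exact hleft a x hx
  | right_absorb b x _ hx => exact hright b x hx

end IsTopGenerating

theorem CStarPresentation.isTopGenerating {G : Type*} (R : CStarPresentation G) :
    IsTopGenerating (Set.range R.gen) := by
  intro M hM h
  have hpoly : ∀ p, R.ofPoly p ∈ M := fun p => by
    induction p using FreeStarAlgebra.induction_on with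
    | scalar r => rw [AlgHomClass.commutes R.ofPoly]; exact M.algebraMap_mem r
    | gen g => exact (h _ ⟨g, rfl⟩).1
    | genStar g =>
      rw [← FreeStarAlgebra.star_of, StarHomClass.map_star R.ofPoly]
      exact (h _ ⟨g, rfl⟩).2
    | mul a b ha hb => rw [map_mul]; exact mul_mem ha hb
    | add a b ha hb => rw [map_add]; exact add_mem ha hb
  exact R.maxSeminorm.toComplete_induction hM hpoly

instance closedIdeal.instNonUnitalCStarAlgebra {A : Type*} [CStarAlgebra A] (S : Set A)
    (hS : ∀ x ∈ S, star x ∈ S) : NonUnitalCStarAlgebra (closedIdeal S hS) :=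
  haveI := isClosed_closedIdeal S hS
  NonUnitalStarSubalgebra.nonUnitalCStarAlgebra (closedIdeal S hS)

theorem mul_mem_closedIdeal_left {A : Type*} [CStarAlgebra A] {S : Set A}
    {hS : ∀ x ∈ S, star x ∈ S} (a : A) {x : A} (hx : x ∈ closedIdeal S hS) :
    a * x ∈ closedIdeal S hS := by
  change a * x ∈ closure (TwoSidedIdeal.span S : Set A)
  exact map_mem_closure (continuous_const_mul a) hx fun y hy => TwoSidedIdeal.mul_mem_left _ a y hy

/-- A stabilization inside a closed ideal, in terms of the ambient algebra. -/
theorem IsStabilization.of_closedIdeal {A B : Type*} [NonUnitalCStarAlgebra A] [CStarAlgebra B]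
    {S : Set B} {hS : ∀ x ∈ S, star x ∈ S} {ρ : A →⋆ₙₐ[ℂ] B} {x : ℕ → B}
    (h : IsColumnFamily ρ x) (hnorm : ∀ a, ‖ρ a‖ = ‖a‖) (hρ : ∀ a, ρ a ∈ closedIdeal S hS)
    (hx : ∀ i, x i ∈ closedIdeal S hS)
    (hdense : (closedIdeal S hS : Set B) ⊆
      (Submodule.span ℂ {b | ∃ i a j, b = x i * ρ a * star (x j)}).topologicalClosure) :
    IsStabilization (NonUnitalStarAlgHom.codRestrict ρ (closedIdeal S hS) hρ)
      (fun i => (⟨x i, hx i⟩ : closedIdeal S hS)) where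
  star_mul_col i j := by
    apply Subtype.ext
    have h1 := h.star_mul_col i j
    split_ifs with hij
    · rwa [if_pos hij] at h1
    · rwa [if_neg hij] at h1
  map_mul_col_zero a := Subtype.ext (h.map_mul_col_zero a)
  norm_map := hnorm
  dense := by
    rw [eq_top_iff]
    rintro ⟨b, hb⟩ -
    change _ ∈ closure _
    -- The ideal carries the subspace topology, so density inside it is the assumed density in the
    -- ambient algebra.
    rw [Topology.IsInducing.subtypeVal.closure_eq_preimage_closure_image]
    refine closure_mono ?_ (hdense hb)
    let L : closedIdeal S hS →ₗ[ℂ] B :=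
      { toFun := Subtype.val, map_add' := fun _ _ => rfl, map_smul' := fun _ _ => rfl }
    change ((Submodule.span ℂ _ : Submodule ℂ B) : Set B) ⊆
      (Submodule.map L (Submodule.span ℂ _) : Submodule ℂ B)
    rw [Submodule.map_span]
    refine Submodule.span_mono ?_
    rintro _ ⟨i, a, j, rfl⟩
    exact ⟨_, ⟨i, a, j, rfl⟩, rfl⟩

section Copy

open FreeStarAlgebra

variable {G : Type*} {B C : Type*} [NonUnitalCStarAlgebra B] [CStarAlgebra C]

theorem lift_copyRel {j : B → G} {f : G → C} (φ : B →⋆ₙₐ[ℂ] C) (hf : ∀ b, f (j b) = φ b) :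
    ∀ r ∈ copyRel j, FreeStarAlgebra.lift f r = 0 := by
  rintro r (((⟨a, b, rfl⟩ | ⟨a, b, rfl⟩) | ⟨c, b, rfl⟩) | ⟨b, rfl⟩)
  · rw [map_sub, map_add, lift_of, lift_of, lift_of, hf, hf, hf, map_add, sub_self]
  · rw [map_sub, map_mul, lift_of, lift_of, lift_of, hf, hf, hf, map_mul, sub_self]
  · rw [map_sub, map_smul, lift_of, lift_of, hf, hf, map_smul, sub_self]
  · rw [map_sub, map_star, lift_of, lift_of, hf, hf, map_star, sub_self]

/-- The homomorphism from `B` to a universal algebra whose presentation contains a copy of `B`. -/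
def CStarPresentation.copyHom (R : CStarPresentation G) (j : B → G) (h : copyRel j ⊆ R.rel) :
    B →⋆ₙₐ[ℂ] R.Universal where
  toFun b := R.gen (j b)
  map_smul' c b := by
    have h1 := R.ofPoly_eq_zero (h (Or.inl (Or.inr ⟨c, b, rfl⟩)))
    rw [map_sub, map_smul, sub_eq_zero] at h1
    exact h1
  map_zero' := by
    have h1 := R.ofPoly_eq_zero (h (Or.inl (Or.inr ⟨0, 0, rfl⟩)))
    rw [map_sub, map_smul, sub_eq_zero, zero_smul, zero_smul] at h1
    exact h1
  map_add' a b := by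
    have h1 := R.ofPoly_eq_zero (h (Or.inl (Or.inl (Or.inl ⟨a, b, rfl⟩))))
    rw [map_sub, map_add, sub_eq_zero] at h1
    exact h1
  map_mul' a b := by
    have h1 := R.ofPoly_eq_zero (h (Or.inl (Or.inl (Or.inr ⟨a, b, rfl⟩))))
    rw [map_sub, map_mul, sub_eq_zero] at h1
    exact h1
  map_star' b := by
    have h1 := R.ofPoly_eq_zero (h (Or.inr ⟨b, rfl⟩))
    rw [map_sub, StarHomClass.map_star, sub_eq_zero] at h1
    exact h1

/-- The unital version of `copyHom`. -/
def CStarPresentation.copyUnitalHom {B : Type*} [CStarAlgebra B] (R : CStarPresentation G)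
    (j : B → G) (h : copyRel j ⊆ R.rel) (h1 : of (j 1) - 1 ∈ R.rel) : B →⋆ₐ[ℂ] R.Universal :=
  have hone : R.gen (j 1) = 1 := by
    have h2 := R.ofPoly_eq_zero h1
    rwa [map_sub, map_one, sub_eq_zero] at h2
  { R.copyHom j h with
    map_one' := hone
    commutes' := fun r => by
      change R.copyHom j h (algebraMap ℂ B r) = _
      rw [Algebra.algebraMap_eq_smul_one, map_smul, Algebra.algebraMap_eq_smul_one]
      exact congrArg (r • ·) hone }

end Copy

section Defect

variable {D : Type*} [CStarAlgebra D] {s : D} (hs : star s * s = 1)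

include hs

theorem star_pow_mul_pow_self (n : ℕ) : star s ^ n * s ^ n = 1 := by
  induction n with
  | zero => simp
  | succ n ih => rw [pow_succ, pow_succ', mul_assoc, ← mul_assoc (star s) s, hs, one_mul, ih]

theorem star_mul_defect : star s * (1 - s * star s) = 0 := by
  rw [mul_sub, mul_one, ← mul_assoc, hs, one_mul, sub_self]

theorem defect_mul : (1 - s * star s) * s = 0 := by
  rw [sub_mul, one_mul, mul_assoc, hs, mul_one, sub_self]

theorem defect_mul_defect : (1 - s * star s) * (1 - s * star s) = 1 - s * star s := by
  rw [mul_sub, mul_one, ← mul_assoc, defect_mul hs, zero_mul, sub_zero]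

omit hs in
theorem star_defect : star (1 - s * star s) = 1 - s * star s := by
  rw [star_sub, star_one, star_mul, star_star]

/-- After cancelling `star s * s = 1`, unequal exponents leave an `s` to the right of the defect
projection or a `star s` to the left of it. Either product is zero. -/
theorem defect_mul_star_pow_mul_pow (i j : ℕ) :
    (1 - s * star s) * star s ^ i * (s ^ j * (1 - s * star s)) =
      if i = j then 1 - s * star s else 0 := by
  rcases lt_trichotomy i j with h | rfl | h
  · obtain ⟨k, rfl⟩ := Nat.exists_eq_add_of_lt h
    rw [if_neg h.ne, add_assoc, pow_add, mul_assoc, ← mul_assoc (star s ^ i), ← mul_assoc (star s ^ i),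
      star_pow_mul_pow_self hs, one_mul, pow_succ', ← mul_assoc, ← mul_assoc, defect_mul hs,
      zero_mul, zero_mul]
  · rw [if_pos rfl, mul_assoc, ← mul_assoc (star s ^ i), star_pow_mul_pow_self hs, one_mul,
      defect_mul_defect hs]
  · obtain ⟨k, rfl⟩ := Nat.exists_eq_add_of_lt h
    rw [if_neg h.ne', add_assoc, add_comm, pow_add, mul_assoc, mul_assoc,
      ← mul_assoc (star s ^ j), star_pow_mul_pow_self hs, one_mul, pow_succ, mul_assoc,
      star_mul_defect hs, mul_zero, mul_zero]

/-- The powers of an isometry carry the range of its defect projection onto mutually orthogonal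
subspaces; this is the source of the matrix units. -/
theorem isColumnFamily_defect {A : Type*} [NonUnitalCStarAlgebra A] {ρ : A →⋆ₙₐ[ℂ] D}
    (hρ : ∀ a, ρ a * (1 - s * star s) = ρ a) :
    IsColumnFamily ρ fun i => s ^ i * (1 - s * star s) where
  star_mul_col i j := by
    rw [star_mul, star_defect, star_pow, defect_mul_star_pow_mul_pow hs, pow_zero, one_mul]
  map_mul_col_zero a := by rw [pow_zero, one_mul, hρ]

end Defect

end

/-! ### The compact operators as the stabilization of the scalars -/

noncomputable section

open Filter Topology

/-- The homomorphism `c ↦ c q` given by a projection `q`. -/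
def scalarHom {B : Type*} [NonUnitalCStarAlgebra B] (q : B) (hq : q * q = q) (hq' : star q = q) :
    ℂ →⋆ₙₐ[ℂ] B where
  toFun c := c • q
  map_smul' c d := by rw [MonoidHom.id_apply, smul_eq_mul, mul_smul]
  map_zero' := zero_smul _ _
  map_add' c d := add_smul _ _ _
  map_mul' c d := by rw [smul_mul_smul_comm, hq]
  map_star' c := by rw [star_smul, hq']

namespace Compacts

open InnerProductSpace

theorem coe_x (i : ℕ) : (x i : EllTwo →L[ℂ] EllTwo) = rankOne ℂ (stdBasis i) (stdBasis 0) := rfl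

theorem inner_stdBasis (i : ℕ) (f : EllTwo) : inner ℂ (stdBasis i) f = f i := by
  rw [stdBasis, lp.inner_single_left]; simp

theorem inner_stdBasis_stdBasis (i j : ℕ) :
    inner ℂ (stdBasis i) (stdBasis j) = if i = j then (1 : ℂ) else 0 := by
  rw [inner_stdBasis, stdBasis]
  split_ifs with h
  · rw [h, lp.single_apply_self]
  · rw [lp.single_apply_ne _ _ _ h]

theorem coe_star_x (i : ℕ) :
    ((star (x i) : Compacts) : EllTwo →L[ℂ] EllTwo) = rankOne ℂ (stdBasis 0) (stdBasis i) := by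
  change star (x i : EllTwo →L[ℂ] EllTwo) = _
  rw [coe_x, ContinuousLinearMap.star_eq_adjoint, adjoint_rankOne]

theorem star_x_mul_mul_x (i j : ℕ) (k : Compacts) :
    star (x i) * k * x j = (inner ℂ (stdBasis i) (k.1 (stdBasis j)) : ℂ) • x 0 := by
  apply Subtype.ext
  change ((star (x i) : Compacts) : EllTwo →L[ℂ] EllTwo) * k.1 * (x j).1 = _ • (x 0).1
  rw [coe_star_x, coe_x, coe_x]
  ext1 f
  simp only [mul_apply_eq_comp, rankOne_apply, smul_apply, map_smul, smul_smul]
  rw [mul_comm]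

theorem star_x_mul_x (i j : ℕ) : star (x i) * x j = if i = j then x 0 else 0 := by
  apply Subtype.ext
  have h : ((star (x i) * x j : Compacts) : EllTwo →L[ℂ] EllTwo) =
      (inner ℂ (stdBasis i) (stdBasis j) : ℂ) • (x 0).1 := by
    change ((star (x i) : Compacts) : EllTwo →L[ℂ] EllTwo) * (x j).1 = _
    rw [coe_star_x, coe_x, coe_x]
    ext1 f
    simp only [mul_apply_eq_comp, rankOne_apply, smul_apply, map_smul, smul_smul]
    rw [mul_comm]
  rw [h, inner_stdBasis_stdBasis]
  split_ifs
  · rw [one_smul]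
  · rw [zero_smul]; rfl

theorem star_x_zero : star (x 0) = x 0 := by
  apply Subtype.ext
  rw [coe_star_x, coe_x]

theorem x_zero_mul_x_zero : x 0 * x 0 = x 0 := by
  have h := star_x_mul_x 0 0
  rwa [star_x_zero, if_pos rfl] at h

/-- The compact operators contain the scalars as multiples of a rank one projection. -/
def scalar : ℂ →⋆ₙₐ[ℂ] Compacts := scalarHom (x 0) x_zero_mul_x_zero star_x_zero

theorem isColumnFamily : IsColumnFamily scalar x where
  star_mul_col := star_x_mul_x
  map_mul_col_zero c := by
    change (c • x 0) * x 0 = c • x 0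
    rw [smul_mul_assoc, x_zero_mul_x_zero]

theorem colProj_apply (n : ℕ) (f : EllTwo) :
    (colProj x n).1 f = ∑ i ∈ Finset.range n, lp.single 2 i (f i) := by
  have h : (colProj x n).1 =
      ∑ i ∈ Finset.range n, rankOne ℂ (stdBasis i) (stdBasis i) := by
    rw [colProj, AddSubmonoidClass.coe_finsetSum]
    refine Finset.sum_congr rfl fun i _ => ?_
    change (x i).1 * ((star (x i) : Compacts) : EllTwo →L[ℂ] EllTwo) = _
    rw [coe_star_x, coe_x]
    ext1 f
    simp only [mul_apply_eq_comp, rankOne_apply, map_smul]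
    rw [inner_stdBasis_stdBasis, if_pos rfl, one_smul]
  rw [h, sum_apply]
  refine Finset.sum_congr rfl fun i _ => ?_
  rw [rankOne_apply, inner_stdBasis, stdBasis, ← lp.single_smul, smul_eq_mul, mul_one]

theorem tendsto_colProj_apply (f : EllTwo) :
    Tendsto (fun n => (colProj x n).1 f) atTop (𝓝 f) := by
  simp only [colProj_apply]
  exact (lp.hasSum_single (by simp) f).tendsto_sum_nat

/-- The projections converge to the identity pointwise and are contractive, so they converge
uniformly on totally bounded sets. The image of the unit ball under `k` is one. -/
theorem tendsto_colProj_mul (k : Compacts) :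
    Tendsto (fun n => colProj x n * k) atTop (𝓝 k) := by
  have hb : TotallyBounded (k.1 '' Metric.closedBall 0 1) :=
    (IsCompactOperator.isCompact_closure_image_closedBall (f := k.1.toLinearMap) k.2
      1).totallyBounded.subset subset_closure
  rw [Metric.tendsto_atTop]
  intro ε hε
  obtain ⟨t, -, htf, ht⟩ := Metric.finite_approx_of_totallyBounded hb (ε / 4) (by positivity)
  have hev : ∀ᶠ n in atTop, ∀ z ∈ t, ‖(colProj x n).1 z - z‖ < ε / 4 := by
    rw [htf.eventually_all]
    intro z _
    have := (tendsto_colProj_apply z)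
    rw [tendsto_iff_norm_sub_tendsto_zero] at this
    exact this.eventually_lt_const (by positivity)
  obtain ⟨N, hN⟩ := eventually_atTop.1 hev
  refine ⟨N, fun n hn => ?_⟩
  rw [dist_eq_norm]
  change ‖(colProj x n).1 * k.1 - k.1‖ < ε
  -- For a net point `z` near `k f`, three errors of at most `ε / 4` occur: `P (k f - z)`, `P z - z`
  -- and `k f - z`. The spare quarter restores strictness, since an operator norm bound is only
  -- non-strict.
  refine (ContinuousLinearMap.opNorm_le_of_unit_norm (C := 3 * (ε / 4)) (by positivity)
    fun f hf => ?_).trans_lt (by linarith)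
  obtain ⟨z, hz, hfz⟩ := Set.mem_iUnion₂.1 (ht ⟨f, by simp [hf], rfl⟩)
  rw [Metric.mem_ball, dist_eq_norm] at hfz
  have h1 : ‖(colProj x n).1 (k.1 f - z)‖ ≤ ‖k.1 f - z‖ := by
    refine ((colProj x n).1.le_opNorm _).trans (mul_le_of_le_one_left (norm_nonneg _) ?_)
    exact isColumnFamily.norm_colProj_le n
  have h2 := hN n hn z hz
  have h3 : ((colProj x n).1 * k.1 - k.1) f =
      (colProj x n).1 (k.1 f - z) + ((colProj x n).1 z - z) - (k.1 f - z) := by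
    rw [sub_apply, mul_apply_eq_comp, map_sub]; abel
  rw [h3]
  refine (norm_sub_le _ _).trans ((add_le_add_left (norm_add_le _ _) _).trans ?_)
  linarith

theorem norm_x_zero : ‖x 0‖ = 1 := by
  change ‖(rankOne ℂ (stdBasis 0) (stdBasis 0) : EllTwo →L[ℂ] EllTwo)‖ = 1
  rw [norm_rankOne, stdBasis, lp.norm_single (by simp), norm_one, mul_one]

theorem scalar_apply (c : ℂ) : scalar c = c • x 0 := rfl

/-- A compact operator cut down on both sides is the finite matrix of the numbers `⟨e i, k e j⟩`. -/
theorem colProj_mul_mul_colProj_mem (k : Compacts) (n m : ℕ) :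
    colProj x n * k * colProj x m ∈
      Submodule.span ℂ {b | ∃ i a j, b = x i * scalar a * star (x j)} := by
  rw [colProj, colProj, Finset.sum_mul, Finset.sum_mul]
  refine sum_mem fun i _ => ?_
  rw [Finset.mul_sum]
  refine sum_mem fun j _ => Submodule.subset_span ?_
  refine ⟨i, inner ℂ (stdBasis i) (k.1 (stdBasis j)), j, ?_⟩
  rw [scalar_apply, ← star_x_mul_mul_x]
  simp only [mul_assoc]

/-- The compact operators are the stabilization of the scalars. -/
theorem isStabilization : IsStabilization scalar x where
  toIsColumnFamily := isColumnFamily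
  norm_map c := by rw [scalar_apply, norm_smul, norm_x_zero, mul_one]
  dense := by
    rw [Submodule.eq_top_iff']
    intro k
    have hZ := Submodule.isClosed_topologicalClosure
      (Submodule.span ℂ {b | ∃ i a j, b = x i * scalar a * star (x j)})
    have h2 : Tendsto (fun m => k * colProj x m) atTop (𝓝 k) := by
      simpa only [star_mul, star_colProj, star_star] using (tendsto_colProj_mul (star k)).star
    -- An iterated limit: first `m → ∞` on the right, then `n → ∞` on the left. The right-hand limit
    -- is the adjoint of the left-hand one.
    refine hZ.mem_of_tendsto (tendsto_colProj_mul k) (Eventually.of_forall fun n =>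
      hZ.mem_of_tendsto (h2.const_mul (colProj x n)) (Eventually.of_forall fun m => ?_))
    rw [← mul_assoc]
    exact Submodule.le_topologicalClosure _ (colProj_mul_mul_colProj_mem k n m)

end Compacts

end

/-! ### The tensor product with the compacts as a stabilization -/

noncomputable section

open Filter Topology

section Tensor

open StandardModule FreeStarAlgebra

theorem nonUnitalStarAlgHom_continuous {A B : Type*} [NonUnitalCStarAlgebra A]
    [NonUnitalCStarAlgebra B] (f : A →⋆ₙₐ[ℂ] B) : Continuous f :=
  AddMonoidHomClass.continuous_of_bound f 1 fun x => by
    rw [one_mul]; exact NonUnitalStarAlgHom.norm_apply_le f x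

/-- The homomorphism `a ↦ L a q` for a projection `q` commuting with the range of `L`. -/
def cutHom {A U : Type*} [CStarAlgebra A] [CStarAlgebra U] (L : A →⋆ₐ[ℂ] U) (q : U)
    (hq : q * q = q) (hq' : star q = q) (hc : ∀ a, Commute (L a) q) : A →⋆ₙₐ[ℂ] U where
  toFun a := L a * q
  map_smul' c a := by rw [map_smul, smul_mul_assoc]; rfl
  map_zero' := by rw [map_zero, zero_mul]
  map_add' a b := by rw [map_add, add_mul]
  map_mul' a b := by
    rw [mul_assoc, ← mul_assoc q, ← (hc b).eq, mul_assoc, hq, ← mul_assoc, map_mul]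
  map_star' a := by rw [star_mul, hq', ← map_star, (hc _).eq]

variable {A U K : Type*} [CStarAlgebra A] [CStarAlgebra U] [NonUnitalCStarAlgebra K]
  {σ : ℂ →⋆ₙₐ[ℂ] K} {x : ℕ → K} (h : IsStabilization σ x) (hσ : ∀ c, σ c = c • x 0)

variable (A) in
/-- The scalars as multiples of the defect projection of the shift. -/
def shiftScalar : ℂ →⋆ₙₐ[ℂ] Operators A :=
  scalarHom (1 - shift A * star (shift A)) (defect_mul_defect star_shift_mul_shift) star_defect

theorem shiftScalar_apply (c : ℂ) : shiftScalar A c = c • (1 - shift A * star (shift A)) := rfl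

variable (A) in
/-- The action of the stabilization of the scalars on the standard module. -/
def stabToOperators : K →⋆ₙₐ[ℂ] Operators A :=
  h.ext (isColumnFamily_defect star_shift_mul_shift (ρ := shiftScalar A) fun c => by
    rw [shiftScalar_apply, smul_mul_assoc, defect_mul_defect star_shift_mul_shift])

theorem stabToOperators_entry (i j : ℕ) (c : ℂ) :
    stabToOperators A h (x i * σ c * star (x j)) =
      shift A ^ i * (1 - shift A * star (shift A)) * (c • (1 - shift A * star (shift A))) *
        star (shift A ^ j * (1 - shift A * star (shift A))) :=
  h.ext_entry _ i j c

include hσ in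
theorem stabToOperators_col_zero :
    stabToOperators A h (x 0) = 1 - shift A * star (shift A) := by
  have h2 := stabToOperators_entry (A := A) h 0 0 1
  rw [hσ, one_smul, h.star_col_zero, h.col_zero_mul_col_zero, h.col_zero_mul_col_zero] at h2
  rw [h2, pow_zero, one_mul, star_defect, one_smul, defect_mul_defect star_shift_mul_shift,
    defect_mul_defect star_shift_mul_shift]

variable (A) in
/-- The representation of `A` by constant diagonal operators. -/
def constHom : A →⋆ₐ[ℂ] Operators A := diagHom fun _ => StarAlgHom.id ℂ A

theorem commute_constHom_shift (a : A) : Commute (constHom A a) (shift A) := by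
  have h := diagHom_mul_shift (β := fun _ => StarAlgHom.id ℂ A) (a := a) (μ := 1)
    fun _ => (one_smul _ _).symm
  rwa [one_smul] at h

/-- A constant diagonal commutes with the shift and its adjoint, hence with every matrix unit built
from them, hence by density with the whole image of `K`. -/
theorem commute_constHom_stab (a : A) (k : K) :
    Commute (constHom A a) (stabToOperators A h k) := by
  have h1 := commute_constHom_shift a
  have h2 : Commute (constHom A a) (star (shift A)) := by
    have := (commute_constHom_shift (star a)).star_star
    rwa [← map_star, star_star] at this
  have h3 : Commute (constHom A a) (1 - shift A * star (shift A)) :=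
    (Commute.one_right _).sub_right (h1.mul_right h2)
  have hκ := nonUnitalStarAlgHom_continuous (stabToOperators A h)
  let κ : K →ₗ[ℂ] Operators A :=
    { toFun := stabToOperators A h, map_add' := map_add _, map_smul' := map_smul _ }
  refine h.mem_of_isClosed (LinearMap.eqLocus (LinearMap.mulLeft ℂ (constHom A a) ∘ₗ κ)
    (LinearMap.mulRight ℂ (constHom A a) ∘ₗ κ))
    (isClosed_eq (continuous_const.mul hκ) (hκ.mul continuous_const)) (fun i c j => ?_) k
  change constHom A a * stabToOperators A h _ = stabToOperators A h _ * constHom A a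
  rw [stabToOperators_entry, star_mul, star_defect, star_pow]
  exact (((h1.pow_right i).mul_right h3).mul_right (h3.smul_right c)).mul_right
    (h3.mul_right (h2.pow_right j))

section Commuting

variable {L : A →⋆ₐ[ℂ] U} {R : K →⋆ₙₐ[ℂ] U} (hc : ∀ a k, Commute (L a) (R k))

/-- The product of `L a` and the image of the initial projection. -/
def stabCorner : A →⋆ₙₐ[ℂ] U :=
  cutHom L (R (x 0)) (by rw [← map_mul, h.col_zero_mul_col_zero])
    (by rw [← map_star, h.star_col_zero]) fun a => hc a _

theorem stabCorner_apply (a : A) : stabCorner h hc a = L a * R (x 0) := rfl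

theorem isColumnFamily_stabCorner : IsColumnFamily (stabCorner h hc) fun i => R (x i) where
  star_mul_col i j := by
    rw [← map_star, ← map_mul, h.star_mul_col]
    split_ifs
    · rfl
    · rw [map_zero]
  map_mul_col_zero a := by
    rw [stabCorner_apply, mul_assoc, ← map_mul, h.col_zero_mul_col_zero]

theorem stabCorner_entry (i j : ℕ) (a : A) :
    R (x i) * stabCorner h hc a * star (R (x j)) = L a * R (x i * star (x j)) := by
  rw [stabCorner_apply, ← mul_assoc, ← (hc a _).eq, mul_assoc (L a), ← map_mul,
    h.col_mul_col_zero, ← map_star, mul_assoc, ← map_mul]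

include hσ in
theorem mul_mem_closure_span (a : A) (k : K) :
    L a * R k ∈ (Submodule.span ℂ {b | ∃ i a j,
      b = R (x i) * stabCorner h hc a * star (R (x j))}).topologicalClosure := by
  set Z := (Submodule.span ℂ {b | ∃ i a j,
      b = R (x i) * stabCorner h hc a * star (R (x j))}).topologicalClosure with hZdef
  have hZ : IsClosed (Z : Set U) := Submodule.isClosed_topologicalClosure _
  have hκ := nonUnitalStarAlgHom_continuous R
  let κ : K →ₗ[ℂ] U := { toFun := R, map_add' := map_add _, map_smul' := map_smul _ }
  refine h.mem_of_isClosed (Z.comap (LinearMap.mulLeft ℂ (L a) ∘ₗ κ))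
    (hZ.preimage (continuous_const.mul hκ)) (fun i c j => ?_) k
  change L a * R _ ∈ Z
  -- The scalar coefficient `c` of the entry of `K` is absorbed into the coefficient from `A`.
  refine Submodule.le_topologicalClosure _ (Submodule.subset_span ⟨i, c • a, j, ?_⟩)
  rw [stabCorner_entry, hσ, mul_smul_comm, h.col_mul_col_zero, smul_mul_assoc, map_smul, map_smul,
    mul_smul_comm, smul_mul_assoc]

include hσ in
theorem mul_entry_mem_closure_span (b : A) {t : U}
    (ht : ∃ i a j, t = R (x i) * stabCorner h hc a * star (R (x j))) :
    L b * t ∈ (Submodule.span ℂ {b | ∃ i a j,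
      b = R (x i) * stabCorner h hc a * star (R (x j))}).topologicalClosure := by
  obtain ⟨i, a, j, rfl⟩ := ht
  rw [stabCorner_entry, ← mul_assoc, ← map_mul]
  exact mul_mem_closure_span h hσ hc _ _

include hσ in
theorem mul_entry_mem_closure_span' (k : K) {t : U}
    (ht : ∃ i a j, t = R (x i) * stabCorner h hc a * star (R (x j))) :
    R k * t ∈ (Submodule.span ℂ {b | ∃ i a j,
      b = R (x i) * stabCorner h hc a * star (R (x j))}).topologicalClosure := by
  obtain ⟨i, a, j, rfl⟩ := ht
  rw [stabCorner_entry, ← mul_assoc, ← (hc _ _).eq, mul_assoc, ← map_mul]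
  exact mul_mem_closure_span h hσ hc _ _

end Commuting

variable (A K) in
/-- The canonical copy of `A` in the algebra generated by commuting copies of `A` and `K`. -/
def tensorLeft : A →⋆ₐ[ℂ] (commutingPresentation A K).Universal :=
  (commutingPresentation A K).copyUnitalHom Sum.inl
    (fun _ hr => Or.inl (Or.inl (Or.inl hr))) (Or.inl (Or.inl (Or.inr rfl)))

variable (A K) in
/-- The canonical copy of `K` in the algebra generated by commuting copies of `A` and `K`. -/
def tensorRight : K →⋆ₙₐ[ℂ] (commutingPresentation A K).Universal :=
  (commutingPresentation A K).copyHom Sum.inr (fun _ hr => Or.inl (Or.inr hr))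

theorem commute_tensor (a : A) (k : K) : Commute (tensorLeft A K a) (tensorRight A K k) :=
  commuting_gen a k

variable (A) in
/-- The action of `A` and `K` on the standard module. -/
def tensorToOperators : (commutingPresentation A K).Universal →⋆ₐ[ℂ] Operators A :=
  (commutingPresentation A K).lift (Sum.elim (constHom A) (stabToOperators A h)) (by
    rintro r (((hr | rfl) | hr) | ⟨a, b, rfl⟩)
    · exact lift_copyRel (j := Sum.inl) (constHom A : A →⋆ₙₐ[ℂ] Operators A) (fun _ => rfl) r hr
    · rw [map_sub, map_one, lift_of, Sum.elim_inl, map_one, sub_self]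
    · exact lift_copyRel (j := Sum.inr) (stabToOperators A h) (fun _ => rfl) r hr
    · rw [map_sub, map_mul, map_mul, lift_of, lift_of, Sum.elim_inl, Sum.elim_inr,
        (commute_constHom_stab h a b).eq, sub_self])

theorem tensorToOperators_left (a : A) :
    tensorToOperators A h (tensorLeft A K a) = constHom A a :=
  CStarPresentation.lift_gen _ _ _ (Sum.inl a)

theorem tensorToOperators_right (k : K) :
    tensorToOperators A h (tensorRight A K k) = stabToOperators A h k :=
  CStarPresentation.lift_gen _ _ _ (Sum.inr k)

include hσ in
-- The upper bound is automatic. For the lower bound, the representation on the standard module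
-- sends `a ⊗ x 0` to the constant diagonal `a` times the defect projection of the shift, whose norm
-- is at least `‖a‖`.
theorem norm_stabCorner_tensor (a : A) : ‖stabCorner h (commute_tensor (A := A)) a‖ = ‖a‖ := by
  refine le_antisymm (NonUnitalStarAlgHom.norm_apply_le (stabCorner h commute_tensor) a) ?_
  have h1 : tensorToOperators A h (stabCorner h commute_tensor a) =
      constHom A a * (1 - shift A * star (shift A)) := by
    rw [stabCorner_apply, map_mul, tensorToOperators_left, tensorToOperators_right,
      stabToOperators_col_zero h hσ]
  calc ‖a‖ ≤ ‖constHom A a * (1 - shift A * star (shift A))‖ := norm_le_norm_diagHom_mul a rfl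
    _ = ‖tensorToOperators A h (stabCorner h commute_tensor a)‖ := by rw [h1]
    _ ≤ _ := NonUnitalStarAlgHom.norm_apply_le (tensorToOperators A h) _

include hσ in
theorem cstarTensor_subset : (CStarTensor A K : Set (commutingPresentation A K).Universal) ⊆
    (Submodule.span ℂ {b | ∃ i a j, b = tensorRight A K (x i) * stabCorner h commute_tensor a *
      star (tensorRight A K (x j))}).topologicalClosure := by
  refine (commutingPresentation A K).isTopGenerating.closedIdeal_subset ?_ ?_ ?_
  · rintro _ ⟨i, a, j, rfl⟩
    refine ⟨j, star a, i, ?_⟩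
    rw [star_mul, star_mul, star_star, map_star, mul_assoc]
  · rintro _ ⟨b | k, rfl⟩ t ht
    · refine ⟨mul_entry_mem_closure_span h hσ commute_tensor b ht, ?_⟩
      rw [← commuting_gen_star_inl]
      exact mul_entry_mem_closure_span h hσ commute_tensor (star b) ht
    · refine ⟨mul_entry_mem_closure_span' h hσ commute_tensor k ht, ?_⟩
      rw [← commuting_gen_star_inr]
      exact mul_entry_mem_closure_span' h hσ commute_tensor (star k) ht
  · rintro _ ⟨⟨a, k⟩, rfl⟩
    exact mul_mem_closure_span h hσ commute_tensor a k

theorem coe_tmul (a : A) (k : K) :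
    (CStarTensor.tmul a k : (commutingPresentation A K).Universal) =
      tensorLeft A K a * tensorRight A K k := rfl

theorem tensorRight_mem (k : K) : tensorRight A K k ∈ CStarTensor A K := by
  have h1 := (CStarTensor.tmul (1 : A) k).2
  rwa [coe_tmul, map_one, one_mul] at h1

include hσ in
/-- The tensor product with the stabilization of the scalars is a stabilization. -/
theorem isStabilization_tensor : IsStabilization
    (NonUnitalStarAlgHom.codRestrict (stabCorner h commute_tensor) (CStarTensor A K)
      fun a => (CStarTensor.tmul a (x 0)).2)
    fun i => (⟨tensorRight A K (x i), tensorRight_mem _⟩ : CStarTensor A K) :=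
  IsStabilization.of_closedIdeal (isColumnFamily_stabCorner h commute_tensor)
    (norm_stabCorner_tensor h hσ) _ _ (cstarTensor_subset h hσ)

/-- Puts `a ⊗ x i` in the form column times corner, on which `IsStabilization.equiv_col_mul`
evaluates the isomorphism. -/
theorem tmul_col (a : A) (i : ℕ) :
    CStarTensor.tmul a (x i) = (⟨tensorRight A K (x i), tensorRight_mem _⟩ : CStarTensor A K) *
      NonUnitalStarAlgHom.codRestrict (stabCorner h commute_tensor) (CStarTensor A K)
        (fun a => (CStarTensor.tmul a (x 0)).2) a := by
  apply Subtype.ext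
  change tensorLeft A K a * tensorRight A K _ =
    tensorRight A K _ * (tensorLeft A K a * tensorRight A K _)
  rw [← mul_assoc, ← (commute_tensor a _).eq, mul_assoc, ← map_mul, h.col_mul_col_zero]

end Tensor

end

/-! ### The defect ideal of a twisted isometry -/

noncomputable section

open Filter Topology StandardModule

/-- An isometry `s` and a copy of the algebra `A` generated by `w`, such that `s` and the copy of
`w` commute up to the scalar `μ`, generate `D`, and are represented on the standard module. -/
structure TwistedIsometry {A D : Type*} [CStarAlgebra A] [CStarAlgebra D] (w : A) (μ : ℂ)
    (β : ℕ → A →⋆ₐ[ℂ] A) (s : D) (L : A →⋆ₐ[ℂ] D) (Ψ : D →⋆ₐ[ℂ] Operators A) : Prop where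
  generates : IsTopGenerating {w}
  rotate : ∀ i, β i w = μ ^ i • w
  isometry : star s * s = 1
  mul_isometry : L w * s = μ • (s * L w)
  star_mul_isometry : star (L w) * s = star μ • (s * star (L w))
  generates_pair : IsTopGenerating {s, L w}
  map_isometry : Ψ s = shift A
  map_gen : Ψ (L w) = diagHom β w

instance defectIdeal.instNonUnitalCStarAlgebra {A : Type*} [CStarAlgebra A] (s : A) :
    NonUnitalCStarAlgebra (defectIdeal s) := closedIdeal.instNonUnitalCStarAlgebra _ _

namespace TwistedIsometry

variable {A D K : Type*} [CStarAlgebra A] [CStarAlgebra D] [NonUnitalCStarAlgebra K]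
  {w : A} {μ : ℂ} {β : ℕ → A →⋆ₐ[ℂ] A} {s : D} {L : A →⋆ₐ[ℂ] D} {Ψ : D →⋆ₐ[ℂ] Operators A}
  (h : TwistedIsometry w μ β s L Ψ)

include h

theorem map_comp (a : A) : Ψ (L a) = diagHom β a := by
  have h1 : Ψ.comp L = diagHom β := h.generates.hom_ext (by rintro _ rfl; exact h.map_gen)
  exact DFunLike.congr_fun h1 a

theorem rotate_zero (a : A) : β 0 a = a := by
  have h1 : β 0 = StarAlgHom.id ℂ A := h.generates.hom_ext (by
    rintro _ rfl
    rw [h.rotate, pow_zero, one_smul]; rfl)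
  rw [h1]; rfl

omit h in
theorem mul_pow_of_mul {b : D} {ν : ℂ} (hb : b * s = ν • (s * b)) (i : ℕ) :
    b * s ^ i = s ^ i * (ν ^ i • b) := by
  induction i with
  | zero => simp
  | succ i ih =>
    rw [pow_succ, ← mul_assoc, ih, mul_smul_comm, smul_mul_assoc, mul_assoc, hb, pow_succ ν,
      mul_smul_comm, mul_smul_comm, mul_assoc, smul_smul]

/-- The elements `a` with this property form a closed subalgebra. The two twisted relations put `w`
and `star w` in it, with factors `μ ^ i` and `star μ ^ i`. -/
theorem mul_pow (i : ℕ) (a : A) : L a * s ^ i = s ^ i * L (β i a) := by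
  let M : Subalgebra ℂ A :=
    { carrier := {a | L a * s ^ i = s ^ i * L (β i a)}
      mul_mem' := fun {a b} (ha : _ = _) (hb : _ = _) => by
        change _ = _
        rw [map_mul, mul_assoc, hb, ← mul_assoc, ha, mul_assoc, map_mul, map_mul]
      add_mem' := fun {a b} (ha : _ = _) (hb : _ = _) => by
        change _ = _
        rw [map_add, add_mul, ha, hb, ← mul_add, ← map_add, ← map_add]
      algebraMap_mem' := fun r => by
        change _ = _
        rw [AlgHomClass.commutes, AlgHomClass.commutes, AlgHomClass.commutes, Algebra.commutes] }
  have hL := starAlgHom_continuous L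
  refine h.generates M (isClosed_eq (hL.mul continuous_const)
    (continuous_const.mul (hL.comp (starAlgHom_continuous (β i))))) ?_ a
  rintro _ rfl
  constructor
  · change _ = _
    rw [mul_pow_of_mul h.mul_isometry, h.rotate, map_smul]
  · change _ = _
    rw [map_star, mul_pow_of_mul h.star_mul_isometry, map_star, h.rotate, star_smul, star_pow,
      map_smul, map_star]

/-- Moving `L w` past `s` produces a factor `μ`, and the adjoint relation `star s * L w = μ • (L w *
star s)` absorbs it. So `L w` commutes exactly with `s * star s`, and the rest of `A` follows by
generation. -/
theorem commute_defect (a : A) : Commute (L a) (1 - s * star s) := by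
  have h1 : Commute (L w) (s * star s) := by
    have h2 := congrArg star h.star_mul_isometry
    rw [star_mul, star_star, star_smul, star_star, star_mul, star_star] at h2
    change _ = _
    rw [← mul_assoc, h.mul_isometry, smul_mul_assoc, mul_assoc, mul_assoc, h2, mul_smul_comm]
  have h2 : Commute (L w) (1 - s * star s) := (Commute.one_right _).sub_right h1
  let M : Subalgebra ℂ A := (Subalgebra.centralizer ℂ {1 - s * star s}).comap (L : A →ₐ[ℂ] D)
  have hmem : ∀ a, a ∈ M ↔ L a * (1 - s * star s) = (1 - s * star s) * L a := fun a => by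
    change L a ∈ Subalgebra.centralizer ℂ _ ↔ _
    rw [Subalgebra.mem_centralizer_iff]
    simp only [Set.mem_singleton_iff, forall_eq]
    exact eq_comm
  have hM : IsClosed (M : Set A) := by
    have h3 : (M : Set A) = {a | L a * (1 - s * star s) = (1 - s * star s) * L a} :=
      Set.ext hmem
    rw [h3]
    have hL := starAlgHom_continuous L
    exact isClosed_eq (hL.mul continuous_const) (continuous_const.mul hL)
  refine (hmem a).1 (h.generates M hM ?_ a)
  rintro _ rfl
  refine ⟨(hmem _).2 h2, (hmem _).2 ?_⟩
  have h3 := h2.star_star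
  rw [star_defect] at h3
  rw [map_star]
  exact h3

omit h in
/-- The representation `a ↦ L a (1 - s s*)` on the corner of the defect projection. -/
def corner (h : TwistedIsometry w μ β s L Ψ) : A →⋆ₙₐ[ℂ] D :=
  cutHom L (1 - s * star s) (defect_mul_defect h.isometry) star_defect h.commute_defect

omit h in
theorem corner_apply (h : TwistedIsometry w μ β s L Ψ) (a : A) :
    h.corner a = L a * (1 - s * star s) := rfl

theorem isColumnFamily : IsColumnFamily h.corner fun i => s ^ i * (1 - s * star s) :=
  isColumnFamily_defect h.isometry fun a => by
    rw [corner_apply, mul_assoc, defect_mul_defect h.isometry]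

theorem col_mul_corner (i : ℕ) (a : A) :
    s ^ i * (1 - s * star s) * h.corner a = s ^ i * L a * (1 - s * star s) := by
  rw [corner_apply, mul_assoc, ← mul_assoc (1 - _), ← (h.commute_defect a).eq, mul_assoc (L a),
    defect_mul_defect h.isometry, ← mul_assoc]

/-- Under `Ψ` the corner element becomes a diagonal operator times the defect projection of the
shift, and its diagonal has entry `a` in place `0` because `β 0` is the identity. -/
theorem norm_corner (a : A) : ‖h.corner a‖ = ‖a‖ := by
  refine le_antisymm (NonUnitalStarAlgHom.norm_apply_le h.corner a) ?_
  have h1 : Ψ (h.corner a) = diagHom β a * (1 - shift A * star (shift A)) := by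
    rw [corner_apply, map_mul, h.map_comp, map_sub, map_one, map_mul, map_star, h.map_isometry]
  calc ‖a‖ ≤ ‖diagHom β a * (1 - shift A * star (shift A))‖ :=
        norm_le_norm_diagHom_mul a (h.rotate_zero a)
    _ = ‖Ψ (h.corner a)‖ := by rw [h1]
    _ ≤ _ := NonUnitalStarAlgHom.norm_apply_le Ψ _

theorem map_mul_entry (b a : A) (i : ℕ) (c : D) :
    L b * (s ^ i * (1 - s * star s) * h.corner a * c) =
      s ^ i * (1 - s * star s) * h.corner (β i b * a) * c := by
  rw [h.col_mul_corner, h.col_mul_corner, map_mul, ← mul_assoc, ← mul_assoc, ← mul_assoc,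
    h.mul_pow, ← mul_assoc]

theorem star_mul_entry (a : A) (i : ℕ) (c : D) :
    star s * (s ^ i * (1 - s * star s) * h.corner a * c) =
      if i = 0 then 0 else s ^ (i - 1) * (1 - s * star s) * h.corner a * c := by
  cases i with
  | zero => rw [pow_zero, one_mul, ← mul_assoc, ← mul_assoc, star_mul_defect h.isometry, zero_mul,
      zero_mul, if_pos rfl]
  | succ i => rw [if_neg i.succ_ne_zero, pow_succ', ← mul_assoc, ← mul_assoc, ← mul_assoc,
      ← mul_assoc, h.isometry, one_mul, Nat.add_sub_cancel]

/-- The entries are stable under adjoints and, up to zero, under left multiplication by the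
generators. Here `s` raises the row index, `star s` lowers it or gives zero in row `0`, and `L w`
and its adjoint only change the coefficient, through `β i`. -/
theorem defectIdeal_subset : (defectIdeal s : Set D) ⊆ (Submodule.span ℂ {b | ∃ i a j,
    b = s ^ i * (1 - s * star s) * h.corner a *
      star (s ^ j * (1 - s * star s))}).topologicalClosure := by
  have hle : ∀ {t}, (∃ i a j, t = s ^ i * (1 - s * star s) * h.corner a *
      star (s ^ j * (1 - s * star s))) → t ∈ (Submodule.span ℂ {b | ∃ i a j,
    b = s ^ i * (1 - s * star s) * h.corner a *
      star (s ^ j * (1 - s * star s))}).topologicalClosure := fun ht =>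
    Submodule.le_topologicalClosure _ (Submodule.subset_span ht)
  refine h.generates_pair.closedIdeal_subset ?_ ?_ ?_
  · rintro _ ⟨i, a, j, rfl⟩
    refine ⟨j, star a, i, ?_⟩
    rw [star_mul, star_star, star_mul (_ * _) (h.corner a), ← map_star, ← mul_assoc]
  · rintro b hb _ ⟨i, a, j, rfl⟩
    rcases hb with rfl | rfl
    · refine ⟨hle ⟨i + 1, a, j, ?_⟩, ?_⟩
      · simp only [pow_succ', mul_assoc]
      · rw [h.star_mul_entry]
        split_ifs
        · exact zero_mem _
        · exact hle ⟨_, _, _, rfl⟩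
    · rw [← map_star, h.map_mul_entry, h.map_mul_entry]
      exact ⟨hle ⟨_, _, _, rfl⟩, hle ⟨_, _, _, rfl⟩⟩
  · rintro _ rfl
    -- The defect projection is itself the entry in place `(0, 0)` with coefficient `1`.
    refine hle ⟨0, 1, 0, ?_⟩
    rw [h.col_mul_corner, map_one, pow_zero, one_mul, one_mul, star_defect,
      defect_mul_defect h.isometry]

omit h in
theorem defect_mem : 1 - s * star s ∈ defectIdeal s := mem_closedIdeal _ rfl

theorem isStabilization : IsStabilization
    (NonUnitalStarAlgHom.codRestrict h.corner (defectIdeal s)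
      fun _ => mul_mem_closedIdeal_left _ defect_mem)
    fun i => (⟨s ^ i * (1 - s * star s), mul_mem_closedIdeal_left _ defect_mem⟩ : defectIdeal s) :=
  IsStabilization.of_closedIdeal h.isColumnFamily h.norm_corner _ _ h.defectIdeal_subset

/-- The ideal generated by the defect of the isometry is the stabilization of `A`. -/
theorem exists_equiv {σ : ℂ →⋆ₙₐ[ℂ] K} {x : ℕ → K} (hK : IsStabilization σ x)
    (hσ : ∀ c, σ c = c • x 0) :
    ∃ φ : CStarTensor A K ≃⋆ₐ[ℂ] defectIdeal s, ∀ a i,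
      (φ (CStarTensor.tmul a (x i)) : D) = s ^ i * L a * (1 - s * star s) := by
  let φ := (isStabilization_tensor (A := A) hK hσ).equiv h.isStabilization
  refine ⟨φ, fun a i => ?_⟩
  have h1 := (isStabilization_tensor (A := A) hK hσ).equiv_col_mul h.isStabilization i a
  exact (congrArg (fun z => (φ z : D)) (tmul_col hK a i)).trans
    ((congrArg Subtype.val h1).trans (h.col_mul_corner i a))

end TwistedIsometry

end

/-! ### Generators and universal properties of the coefficient algebras -/

noncomputable section

open StandardModule FreeStarAlgebra

/-- Stone–Weierstrass: the inclusion of the circle in the plane separates points. -/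
theorem CircleAlgebra.isTopGenerating : IsTopGenerating {CircleAlgebra.u} := by
  intro M hM h a
  have h1 : (StarAlgebra.adjoin ℂ {CircleAlgebra.u}).topologicalClosure = ⊤ := by
    refine ContinuousMap.starSubalgebra_topologicalClosure_eq_top_of_separatesPoints _ ?_
    intro z w hzw
    refine ⟨CircleAlgebra.u, ⟨CircleAlgebra.u, StarAlgebra.self_mem_adjoin_singleton ℂ _, rfl⟩, ?_⟩
    exact fun h => hzw (Subtype.ext h)
  have h2 : (StarAlgebra.adjoin ℂ {CircleAlgebra.u}).toSubalgebra ≤ M := by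
    rw [StarAlgebra.adjoin_toSubalgebra, Algebra.adjoin_le_iff]
    rintro x (rfl | hx)
    · exact (h _ rfl).1
    · rw [Set.mem_star, Set.mem_singleton_iff] at hx
      rw [← star_star x, hx]
      exact (h _ rfl).2
  have h3 : a ∈ (StarAlgebra.adjoin ℂ {CircleAlgebra.u}).topologicalClosure := by
    rw [h1]; trivial
  exact closure_minimal h2 hM h3

/-- The homomorphism from the functions on the circle determined by a unitary. -/
def CircleAlgebra.lift {D : Type*} [CStarAlgebra D] (U : D) (hU : U ∈ unitary D) :
    CircleAlgebra →⋆ₐ[ℂ] D :=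
  have : IsStarNormal U := ⟨by
    rw [Commute, SemiconjBy, Unitary.star_mul_self_of_mem hU, Unitary.mul_star_self_of_mem hU]⟩
  -- The spectrum of a unitary lies on the circle, so functions are restricted to it and then fed to
  -- the continuous functional calculus.
  (cfcHom (p := IsStarNormal) (R := ℂ) (a := U) this).comp
    (ContinuousMap.compStarAlgHom' ℂ ℂ
      ⟨fun z : spectrum ℂ U => (⟨z, spectrum.subset_circle_of_unitary hU z.2⟩ : Circle),
        by fun_prop⟩)

theorem CircleAlgebra.lift_u {D : Type*} [CStarAlgebra D] (U : D) (hU : U ∈ unitary D) :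
    CircleAlgebra.lift U hU CircleAlgebra.u = U :=
  cfcHom_id (p := IsStarNormal) (R := ℂ) (a := U) _

/-- The rotation of the circle by `z`, acting on functions. -/
def CircleAlgebra.rotate (z : Circle) : CircleAlgebra →⋆ₐ[ℂ] CircleAlgebra :=
  ContinuousMap.compStarAlgHom' ℂ ℂ ⟨fun x => z * x, continuous_const_mul z⟩

theorem CircleAlgebra.rotate_u (z : Circle) :
    CircleAlgebra.rotate z CircleAlgebra.u = (z : ℂ) • CircleAlgebra.u := by
  ext x
  exact Circle.coe_mul z x

theorem CircleAlgebra.star_u_mul_u : star CircleAlgebra.u * CircleAlgebra.u = 1 := by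
  ext x
  change (starRingEnd ℂ) (x : ℂ) * (x : ℂ) = 1
  rw [Complex.conj_mul', Circle.norm_coe, Complex.ofReal_one, one_pow]

theorem Circle.star_coe_mul_coe (z : Circle) : star (z : ℂ) * z = 1 := by
  change (starRingEnd ℂ) (z : ℂ) * (z : ℂ) = 1
  rw [Complex.conj_mul', Circle.norm_coe, Complex.ofReal_one, one_pow]

theorem Toeplitz.isTopGenerating : IsTopGenerating {Toeplitz.v} := by
  have h := toeplitzPresentation.isTopGenerating
  rwa [Set.range_unique] at h

/-- The homomorphism from the Toeplitz algebra determined by an isometry. -/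
def Toeplitz.lift {D : Type*} [CStarAlgebra D] (s : D) (hs : star s * s = 1) : Toeplitz →⋆ₐ[ℂ] D :=
  toeplitzPresentation.lift (fun _ => s) (by
    rintro r rfl
    rw [map_sub, map_mul, map_star, lift_of, map_one, hs, sub_self])

theorem Toeplitz.lift_v {D : Type*} [CStarAlgebra D] (s : D) (hs : star s * s = 1) :
    Toeplitz.lift s hs Toeplitz.v = s :=
  toeplitzPresentation.lift_gen _ _ ()

section Twisted

variable {D : Type*} [CStarAlgebra D] {s w : D} (hs : star s * s = 1) (hw : star w * w = 1) (z : Circle)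

include hs hw in
-- For `y = w * s - z • (s * w)`, the four terms of `star y * y` reduce to `1 - 1 - 1 + 1` by the
-- hypothesis, its adjoint, the isometry relations and `|z| = 1`. So `y = 0` by the C*-identity.
theorem mul_eq_of_star_mul_eq (h : star w * s = star (z : ℂ) • (s * star w)) :
    w * s = (z : ℂ) • (s * w) := by
  have h' : star s * w = (z : ℂ) • (w * star s) := by
    have := congrArg star h
    rwa [star_mul, star_star, star_smul, star_star, star_mul, star_star] at this
  have hz := Circle.star_coe_mul_coe z
  rw [← sub_eq_zero, ← CStarRing.star_mul_self_eq_zero_iff]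
  have e1 : star s * star w * (w * s) = 1 := by
    rw [mul_assoc, ← mul_assoc (star w), hw, one_mul, hs]
  have e2 : star s * star w * (s * w) = star (z : ℂ) • 1 := by
    rw [mul_assoc, ← mul_assoc (star w), h, smul_mul_assoc, mul_smul_comm, mul_assoc s, hw, mul_one,
      hs]
  have e3 : star w * star s * (w * s) = (z : ℂ) • 1 := by
    rw [mul_assoc, ← mul_assoc (star s), h', smul_mul_assoc, mul_smul_comm, mul_assoc w, hs, mul_one,
      hw]
  have e4 : star w * star s * (s * w) = 1 := by
    rw [mul_assoc, ← mul_assoc (star s), hs, one_mul, hw]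
  rw [star_sub, star_smul, star_mul, star_mul, sub_mul, mul_sub, mul_sub, e1, mul_smul_comm, e2,
    smul_mul_assoc, e3, smul_mul_smul_comm, e4, smul_smul, smul_smul, hz, mul_comm (z : ℂ), hz]
  simp

end Twisted

theorem diagHom_rotation_mul_shift {A : Type*} [CStarAlgebra A] {β : ℕ → A →⋆ₐ[ℂ] A} {w : A} {μ : ℂ}
    (h : ∀ i, β i w = μ ^ i • w) :
    diagHom β w * shift A = μ • (shift A * diagHom β w) ∧
      star (diagHom β w) * shift A = star μ • (shift A * star (diagHom β w)) := by
  refine ⟨diagHom_mul_shift fun i => ?_, ?_⟩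
  · rw [h, h, pow_succ', mul_smul]
  · rw [← map_star]
    refine diagHom_mul_shift fun i => ?_
    rw [map_star, map_star, h, h, pow_succ', mul_smul, star_smul]

/-! ### The crossed product of the Toeplitz algebra -/

section Crossed

variable (θ : ℝ)

theorem ToeplitzCrossed.u_mem_unitary : ToeplitzCrossed.u θ ∈ unitary (ToeplitzCrossed θ) := by
  refine Unitary.mem_iff.2 ⟨?_, ?_⟩
  · have h := (crossedPresentation (Toeplitz.rotate (twist θ))).ofPoly_eq_zero
      (Or.inl (Or.inr (Or.inl rfl)))
    rw [map_sub, map_mul, StarHomClass.map_star, map_one, sub_eq_zero] at h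
    exact h
  · have h := (crossedPresentation (Toeplitz.rotate (twist θ))).ofPoly_eq_zero
      (Or.inl (Or.inr (Or.inr rfl)))
    rw [map_sub, map_mul, StarHomClass.map_star, map_one, sub_eq_zero] at h
    exact h

/-- The canonical copy of the Toeplitz algebra in the crossed product. -/
def ToeplitzCrossed.incl : Toeplitz →⋆ₐ[ℂ] ToeplitzCrossed θ :=
  (crossedPresentation (Toeplitz.rotate (twist θ))).copyUnitalHom Sum.inl
    (fun _ hr => Or.inl (Or.inl (Or.inl hr))) (Or.inl (Or.inl (Or.inr rfl)))

theorem ToeplitzCrossed.incl_v : ToeplitzCrossed.incl θ Toeplitz.v = ToeplitzCrossed.v θ := rfl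

theorem ToeplitzCrossed.star_v_mul_v :
    star (ToeplitzCrossed.v θ) * ToeplitzCrossed.v θ = 1 := by
  rw [← incl_v, ← map_star, ← map_mul, Toeplitz.star_v_mul_v, map_one]

theorem ToeplitzCrossed.u_mul_v_mul_star_u :
    ToeplitzCrossed.u θ * ToeplitzCrossed.v θ * star (ToeplitzCrossed.u θ) =
      (twist θ : ℂ) • ToeplitzCrossed.v θ := by
  have h := (crossedPresentation (Toeplitz.rotate (twist θ))).ofPoly_eq_zero
    (Or.inr ⟨Toeplitz.v, rfl⟩)
  rw [map_sub, map_mul, map_mul, StarHomClass.map_star, sub_eq_zero] at h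
  refine h.trans ?_
  change incl θ (Toeplitz.rotate (twist θ) Toeplitz.v) = _
  rw [← incl_v, ← map_smul]
  exact congrArg _ (Toeplitz.rotateHom_v _)

theorem ToeplitzCrossed.star_u_mul_v :
    star (ToeplitzCrossed.u θ) * ToeplitzCrossed.v θ =
      star (twist θ : ℂ) • (ToeplitzCrossed.v θ * star (ToeplitzCrossed.u θ)) := by
  have h := congrArg (fun x => star (twist θ : ℂ) • (star (ToeplitzCrossed.u θ) * x))
    (u_mul_v_mul_star_u θ)
  simp only [mul_smul_comm, smul_smul] at h
  rw [Circle.star_coe_mul_coe, one_smul, ← mul_assoc, ← mul_assoc,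
    Unitary.star_mul_self_of_mem (u_mem_unitary θ), one_mul] at h
  exact h.symm

/-- The rotations of the circle by the powers of `exp (2 π i θ)`. -/
def circleRotations (i : ℕ) : CircleAlgebra →⋆ₐ[ℂ] CircleAlgebra := CircleAlgebra.rotate (twist θ ^ i)

theorem circleRotations_u (i : ℕ) :
    circleRotations θ i CircleAlgebra.u = (twist θ : ℂ) ^ i • CircleAlgebra.u := by
  rw [circleRotations, CircleAlgebra.rotate_u, Circle.coe_pow]

/-- The unitary on the standard module representing `u`. -/
def circleDiag : Operators CircleAlgebra := diagHom (circleRotations θ) CircleAlgebra.u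

theorem circleDiag_mem_unitary : circleDiag θ ∈ unitary (Operators CircleAlgebra) := by
  refine Unitary.mem_iff.2 ⟨?_, ?_⟩
  · rw [circleDiag, ← map_star, ← map_mul, CircleAlgebra.star_u_mul_u, map_one]
  · rw [circleDiag, ← map_star, ← map_mul, mul_comm, CircleAlgebra.star_u_mul_u, map_one]

/-- Conjugation by a unitary is an automorphism, so both sides are `*`-homomorphisms in `t` and need
only be compared at `v`, where the twisted relation between diagonal and shift applies. -/
theorem circleDiag_covariant (t : Toeplitz) :
    circleDiag θ * Toeplitz.lift (shift CircleAlgebra) star_shift_mul_shift t *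
        star (circleDiag θ) =
      Toeplitz.lift (shift CircleAlgebra) star_shift_mul_shift (Toeplitz.rotate (twist θ) t) := by
  set τ := Toeplitz.lift (shift CircleAlgebra) star_shift_mul_shift with hτ
  let U : unitary (Operators CircleAlgebra) := ⟨_, circleDiag_mem_unitary θ⟩
  have h : (Unitary.conjStarAlgAut ℂ (Operators CircleAlgebra) U :
      Operators CircleAlgebra →⋆ₐ[ℂ] Operators CircleAlgebra).comp τ =
      τ.comp (Toeplitz.rotateHom (twist θ)) := by
    refine Toeplitz.isTopGenerating.hom_ext ?_
    rintro _ rfl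
    change circleDiag θ * τ Toeplitz.v * star (circleDiag θ) =
      τ (Toeplitz.rotateHom (twist θ) Toeplitz.v)
    rw [Toeplitz.rotateHom_v, map_smul, hτ, Toeplitz.lift_v, circleDiag,
      (diagHom_rotation_mul_shift (circleRotations_u θ)).1, smul_mul_assoc, mul_assoc,
      ← circleDiag, Unitary.mul_star_self_of_mem (circleDiag_mem_unitary θ), mul_one]
  exact DFunLike.congr_fun h t

/-- The representation of the crossed product on the standard module. -/
def ToeplitzCrossed.toOperators : ToeplitzCrossed θ →⋆ₐ[ℂ] Operators CircleAlgebra :=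
  (crossedPresentation (Toeplitz.rotate (twist θ))).lift
    (Sum.elim (Toeplitz.lift (shift CircleAlgebra) star_shift_mul_shift) fun _ => circleDiag θ) (by
    rintro r (((hr | rfl) | (rfl | rfl)) | ⟨a, rfl⟩)
    · exact lift_copyRel (j := Sum.inl) (Toeplitz.lift (shift CircleAlgebra) star_shift_mul_shift :
        Toeplitz →⋆ₙₐ[ℂ] Operators CircleAlgebra) (fun _ => rfl) r hr
    · rw [map_sub, map_one, lift_of, Sum.elim_inl, map_one, sub_self]
    · rw [map_sub, map_one, map_mul, map_star, lift_of, Sum.elim_inr,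
        Unitary.star_mul_self_of_mem (circleDiag_mem_unitary θ), sub_self]
    · rw [map_sub, map_one, map_mul, map_star, lift_of, Sum.elim_inr,
        Unitary.mul_star_self_of_mem (circleDiag_mem_unitary θ), sub_self]
    · rw [map_sub, map_mul, map_mul, map_star, lift_of, lift_of, lift_of, Sum.elim_inr,
        Sum.elim_inl, Sum.elim_inl, circleDiag_covariant, sub_self])

theorem ToeplitzCrossed.twistedIsometry :
    TwistedIsometry CircleAlgebra.u (twist θ : ℂ) (circleRotations θ) (ToeplitzCrossed.v θ)
      (CircleAlgebra.lift (ToeplitzCrossed.u θ) (ToeplitzCrossed.u_mem_unitary θ))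
      (ToeplitzCrossed.toOperators θ) where
  generates := CircleAlgebra.isTopGenerating
  rotate := circleRotations_u θ
  isometry := star_v_mul_v θ
  mul_isometry := by
    rw [CircleAlgebra.lift_u]
    exact mul_eq_of_star_mul_eq (star_v_mul_v θ) (Unitary.star_mul_self_of_mem (u_mem_unitary θ))
      (twist θ) (star_u_mul_v θ)
  star_mul_isometry := by rw [CircleAlgebra.lift_u]; exact star_u_mul_v θ
  generates_pair := by
    rw [CircleAlgebra.lift_u]
    -- The presentation has a generator for every element of the Toeplitz algebra; these all lie in
    -- the closed subalgebra generated by `v` and its adjoint.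
    have h := Toeplitz.isTopGenerating.trans (T := {ToeplitzCrossed.u θ}) (incl θ) (by
      have h1 := (crossedPresentation (Toeplitz.rotate (twist θ))).isTopGenerating
      refine fun M hM h2 => h1 M hM ?_
      rintro _ ⟨a | ⟨⟩, rfl⟩
      · exact h2 _ (Or.inl ⟨a, rfl⟩)
      · exact h2 _ (Or.inr rfl))
    rw [Set.image_singleton] at h
    exact h
  map_isometry := (CStarPresentation.lift_gen _ _ _ (Sum.inl Toeplitz.v)).trans
    (Toeplitz.lift_v _ _)
  map_gen := by
    rw [CircleAlgebra.lift_u]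
    exact CStarPresentation.lift_gen _ _ _ (Sum.inr ())

end Crossed

/-! ### The tensor twist of two isometries -/

section TensorTwist

/-- The rotations of the Toeplitz algebra by the powers of `z`. -/
def toeplitzRotations (z : Circle) (i : ℕ) : Toeplitz →⋆ₐ[ℂ] Toeplitz := Toeplitz.rotateHom (z ^ i)

theorem toeplitzRotations_v (z : Circle) (i : ℕ) :
    toeplitzRotations z i Toeplitz.v = (z : ℂ) ^ i • Toeplitz.v := by
  rw [toeplitzRotations, Toeplitz.rotateHom_v, Circle.coe_pow]

/-- The diagonal isometry on the standard module of the Toeplitz algebra. -/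
def toeplitzDiag (z : Circle) : Operators Toeplitz := diagHom (toeplitzRotations z) Toeplitz.v

theorem star_toeplitzDiag_mul_self (z : Circle) : star (toeplitzDiag z) * toeplitzDiag z = 1 := by
  rw [toeplitzDiag, ← map_star, ← map_mul, Toeplitz.star_v_mul_v, map_one]

theorem star_toeplitzDiag_mul_shift (z : Circle) :
    star (toeplitzDiag z) * shift Toeplitz =
      star (z : ℂ) • (shift Toeplitz * star (toeplitzDiag z)) :=
  (diagHom_rotation_mul_shift (toeplitzRotations_v z)).2

theorem star_shift_mul_toeplitzDiag (z : Circle) :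
    star (shift Toeplitz) * toeplitzDiag z =
      (z : ℂ) • (toeplitzDiag z * star (shift Toeplitz)) := by
  have := congrArg star (star_toeplitzDiag_mul_shift z)
  rwa [star_mul, star_star, star_smul, star_star, star_mul, star_star] at this

variable (θ : ℝ)

namespace TensorTwist

theorem star_u_mul_u : star (u θ) * u θ = 1 := by
  have h := (tensorTwistPresentation θ).ofPoly_eq_zero (Or.inl rfl)
  rw [map_sub, map_mul, StarHomClass.map_star, map_one, sub_eq_zero] at h
  exact h

theorem star_v_mul_v : star (v θ) * v θ = 1 := by
  have h := (tensorTwistPresentation θ).ofPoly_eq_zero (Or.inr (Or.inl rfl))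
  rw [map_sub, map_mul, StarHomClass.map_star, map_one, sub_eq_zero] at h
  exact h

theorem star_u_mul_v : star (u θ) * v θ = star (twist θ : ℂ) • (v θ * star (u θ)) := by
  have h := (tensorTwistPresentation θ).ofPoly_eq_zero (Or.inr (Or.inr rfl))
  rw [map_sub, map_smul, map_mul, map_mul, StarHomClass.map_star, sub_eq_zero] at h
  exact h

/-- The adjoint of the defining relation: exchanging `u` and `v` replaces the twist by its inverse,
which lets the second ideal be treated like the first. -/
theorem star_v_mul_u :
    star (v θ) * u θ = star (((twist θ)⁻¹ : Circle) : ℂ) • (u θ * star (v θ)) := by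
  have h := congrArg star (star_u_mul_v θ)
  rw [star_mul, star_star, star_smul, star_star, star_mul, star_star] at h
  rw [h, Circle.coe_inv_eq_conj]
  exact congrArg (· • _) (star_star (twist θ : ℂ)).symm

/-- The representation of the tensor twist given by isometries satisfying the relation. -/
def lift {D : Type*} [CStarAlgebra D] (a b : D) (ha : star a * a = 1) (hb : star b * b = 1)
    (hab : star a * b = star (twist θ : ℂ) • (b * star a)) : TensorTwist θ →⋆ₐ[ℂ] D :=
  (tensorTwistPresentation θ).lift (fun | .u => a | .v => b) (by
    rintro r (rfl | rfl | rfl)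
    · rw [map_sub, map_mul, map_star, lift_of, map_one, ha, sub_self]
    · rw [map_sub, map_mul, map_star, lift_of, map_one, hb, sub_self]
    · rw [map_sub, map_smul, map_mul, map_mul, map_star, lift_of, lift_of, hab, sub_self])

theorem lift_u {D : Type*} [CStarAlgebra D] (a b : D) (ha : star a * a = 1) (hb : star b * b = 1)
    (hab : star a * b = star (twist θ : ℂ) • (b * star a)) : lift θ a b ha hb hab (u θ) = a :=
  CStarPresentation.lift_gen _ _ _ TwistGen.u

theorem lift_v {D : Type*} [CStarAlgebra D] (a b : D) (ha : star a * a = 1) (hb : star b * b = 1)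
    (hab : star a * b = star (twist θ : ℂ) • (b * star a)) : lift θ a b ha hb hab (v θ) = b :=
  CStarPresentation.lift_gen _ _ _ TwistGen.v

theorem isTopGenerating : IsTopGenerating {v θ, u θ} := by
  refine fun M hM h => (tensorTwistPresentation θ).isTopGenerating M hM ?_
  rintro _ ⟨_ | _, rfl⟩
  · exact h _ (Or.inr rfl)
  · exact h _ (Or.inl rfl)

/-- Here `v` is represented by the shift, and `u` by the diagonal isometry with entries `λ ^ i v`
over the Toeplitz algebra. -/
theorem twistedIsometry_v :
    TwistedIsometry Toeplitz.v (twist θ : ℂ) (toeplitzRotations (twist θ)) (v θ)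
      (Toeplitz.lift (u θ) (star_u_mul_u θ))
      (lift θ (toeplitzDiag (twist θ)) (shift Toeplitz) (star_toeplitzDiag_mul_self _)
        star_shift_mul_shift (star_toeplitzDiag_mul_shift _)) where
  generates := Toeplitz.isTopGenerating
  rotate := toeplitzRotations_v _
  isometry := star_v_mul_v θ
  mul_isometry := by
    rw [Toeplitz.lift_v]
    exact mul_eq_of_star_mul_eq (star_v_mul_v θ) (star_u_mul_u θ) _ (star_u_mul_v θ)
  star_mul_isometry := by rw [Toeplitz.lift_v]; exact star_u_mul_v θ
  generates_pair := by rw [Toeplitz.lift_v]; exact isTopGenerating θ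
  map_isometry := lift_v ..
  map_gen := by rw [Toeplitz.lift_v]; exact lift_u ..

/-- The roles are exchanged: `u` becomes the shift and `v` the diagonal isometry, and the diagonal
must rotate by the inverse twist to satisfy the same defining relation. -/
theorem twistedIsometry_u :
    TwistedIsometry Toeplitz.v (((twist θ)⁻¹ : Circle) : ℂ) (toeplitzRotations (twist θ)⁻¹) (u θ)
      (Toeplitz.lift (v θ) (star_v_mul_v θ))
      (lift θ (shift Toeplitz) (toeplitzDiag (twist θ)⁻¹) star_shift_mul_shift
        (star_toeplitzDiag_mul_self _) (by
          rw [star_shift_mul_toeplitzDiag, Circle.coe_inv_eq_conj]; rfl)) where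
  generates := Toeplitz.isTopGenerating
  rotate := toeplitzRotations_v _
  isometry := star_u_mul_u θ
  mul_isometry := by
    rw [Toeplitz.lift_v]
    exact mul_eq_of_star_mul_eq (star_u_mul_u θ) (star_v_mul_v θ) _ (star_v_mul_u θ)
  star_mul_isometry := by rw [Toeplitz.lift_v]; exact star_v_mul_u θ
  generates_pair := by
    rw [Toeplitz.lift_v, Set.pair_comm]
    exact isTopGenerating θ
  map_isometry := lift_u ..
  map_gen := by rw [Toeplitz.lift_v]; exact lift_v ..

end TensorTwist

end TensorTwist

end

/-! ### The three isomorphisms -/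

noncomputable section

/-- The ideal generated by the defect of a twisted isometry, as a stabilization of `A`. -/
theorem TwistedIsometry.exists_equiv_compacts {A D : Type*} [CStarAlgebra A] [CStarAlgebra D]
    {w : A} {μ : ℂ} {β : ℕ → A →⋆ₐ[ℂ] A} {s : D} {L : A →⋆ₐ[ℂ] D}
    {Ψ : D →⋆ₐ[ℂ] StandardModule.Operators A} (h : TwistedIsometry w μ β s L Ψ) {d : D}
    (hd : L w = d) :
    ∃ φ : CStarTensor A Compacts ≃⋆ₐ[ℂ] defectIdeal s, ∀ i : ℕ,
      (φ (CStarTensor.tmul w (Compacts.x i)) : D) = s ^ i * d * (1 - s * star s) ∧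
      (φ (CStarTensor.tmul 1 (Compacts.x i)) : D) = s ^ i * (1 - s * star s) := by
  have h1 := h.exists_equiv (K := Compacts) Compacts.isStabilization Compacts.scalar_apply
  exact h1.imp fun φ hφ i =>
    ⟨(hφ w i).trans (by rw [hd]), (hφ 1 i).trans (by rw [map_one, mul_one])⟩

end

theorem mainTheorem10 (θ : ℝ) :
    (∃ φ : CStarTensor CircleAlgebra Compacts ≃⋆ₐ[ℂ] defectIdeal (ToeplitzCrossed.v θ),
      ∀ i : ℕ, (φ (CStarTensor.tmul CircleAlgebra.u (Compacts.x i)) : ToeplitzCrossed θ) =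
        ToeplitzCrossed.v θ ^ i * ToeplitzCrossed.u θ *
          (1 - ToeplitzCrossed.v θ * star (ToeplitzCrossed.v θ))) ∧
    (∃ φ : CStarTensor Toeplitz Compacts ≃⋆ₐ[ℂ] defectIdeal (TensorTwist.v θ),
      ∀ i : ℕ,
        (φ (CStarTensor.tmul Toeplitz.v (Compacts.x i)) : TensorTwist θ) =
          TensorTwist.v θ ^ i * TensorTwist.u θ *
            (1 - TensorTwist.v θ * star (TensorTwist.v θ)) ∧
        (φ (CStarTensor.tmul 1 (Compacts.x i)) : TensorTwist θ) =
          TensorTwist.v θ ^ i * (1 - TensorTwist.v θ * star (TensorTwist.v θ))) ∧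
    (∃ φ : CStarTensor Toeplitz Compacts ≃⋆ₐ[ℂ] defectIdeal (TensorTwist.u θ),
      ∀ i : ℕ,
        (φ (CStarTensor.tmul Toeplitz.v (Compacts.x i)) : TensorTwist θ) =
          TensorTwist.u θ ^ i * TensorTwist.v θ *
            (1 - TensorTwist.u θ * star (TensorTwist.u θ)) ∧
        (φ (CStarTensor.tmul 1 (Compacts.x i)) : TensorTwist θ) =
          TensorTwist.u θ ^ i * (1 - TensorTwist.u θ * star (TensorTwist.u θ))) := by
  have h₁ := (ToeplitzCrossed.twistedIsometry θ).exists_equiv_compacts (CircleAlgebra.lift_u _ _)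
  have h₂ := (TensorTwist.twistedIsometry_v θ).exists_equiv_compacts (Toeplitz.lift_v _ _)
  have h₃ := (TensorTwist.twistedIsometry_u θ).exists_equiv_compacts (Toeplitz.lift_v _ _)
  exact ⟨h₁.imp fun _ h i => (h i).1, h₂, h₃⟩
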